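/- Let $X\subset\mathbb{R}^n$ be convex and compact, let $g$ be a real-valued function that is smooth ($C^\infty$) on a neighbourhood of $X\times\mathbb{R}^m$, let $Y,Y'\subset\mathbb{R}^m$ be compact with $Y\subset\operatorname{int}Y'$, and let $y_0\in Y$. Assume that on $X\times\mathbb{R}^m$ the gradient $\nabla g$ is Lipschitz, $\nabla^2_{yy}g$ is Lipschitz (Euclidean norm on $\mathbb{R}^{n+m}$, operator norm on matrices) with constant $\overline{\overline{L}}_g>0$, and $g$ is bounded below, and that for every $x\in X$ the set $\{y: g(x,y)\le g(x,y_0)\}$ is compact and contained in $Y$. Call $(x,y)$ a stationary point if $\nabla_y g(x,y)=0$, and degenerate if moreover $\det\nabla^2_{yy}g(x,y)=0$. The bifurcation set is $\widetilde{X}=\{x\in X:\ g(x,\cdot)\text{ has a degenerate stationary point}\}$, and $\widetilde{X}_\delta=\{x\in X:\operatorname{dist}(x,\widetilde{X})\le\delta\}$, with $\operatorname{dist}(x,\emptyset)=\infty$. For $r\geq 0$ let $\mathrm{Crit}(x)=\{y\in Y':\nabla_y g(x,y)=0\}$ and $\mathrm{Crit}_r(x)=\{y\in\mathbb{R}^m:\operatorname{dist}(y,\mathrm{Crit}(x))\le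 r\}$. Define, with $\inf\emptyset=\infty$ (and $\mathrm{Crit}_\infty(x)=\mathbb{R}^m$), $$\mu(\delta)=\inf\{|\lambda|:\ x\in X\setminus\widetilde{X}_\delta,\ y\in\mathrm{Crit}(x),\ \lambda\text{ an eigenvalue of }\nabla^2_{yy}g(x,y)\},$$ $$\alpha(\delta,r)=\inf\{\|\nabla_y g(x,y)\|:\ x\in X\setminus\widetilde{X}_\delta,\ y\in Y\setminus\mathrm{Crit}_r(x)\}.$$ Suppose that every degenerate stationary point $(\bar x,\bar y)$ with $\bar x\in X$ is a fold: $0$ is a simple eigenvalue of $\nabla^2_{yy}g(\bar x,\bar y)$ and, for a corresponding unit eigenvector $v$, the vector $w:=\nabla_x\big(\nabla_y g(x,y)^\top v\big)\big|_{(\bar x,\bar y)}$ is nonzero and $\nabla^3_{yyy}g(\bar x,\bar y)[v,v,v]\neq0$. Suppose also that, whenever $\bar x$ lies on the boundary of $X$, the hyperplane $\{x: w^\top(x-\bar x)=0\}$ is not tangent to $X$ at $\bar x$, in the sense that either $w^\top(x-\bar x)$ takes both positive and negative values for $x\in X$, or there is $c>0$ with $|w^\top(x-\bar x)|\ge c\|x-\bar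 x\|$ for all $x\in X$. Then there are constants $D_1,D_2,D_3,D_4>0$ such that for all $\delta>0$ $$\mu(\delta)\ \ge\ \min\{D_1\sqrt{\delta},\,D_2\},\qquad \alpha\!\left(\delta,\frac{\mu(\delta)}{2\overline{\overline{L}}_g}\right)\ \ge\ \min\{D_3\,\delta,\,D_4\}.$$ In words, Hessian eigenvalues at stationary points decay at most like the square root of the distance to the bifurcation set, and gradient lower bounds decay at most linearly. -/

import Mathlib

open scoped ContDiff

namespace FoldBifurcation

noncomputable section

variable {n m : ℕ}

/-- The partial gradient `∇_x g(x, y)`. -/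
def gradX (g : EuclideanSpace ℝ (Fin n) → EuclideanSpace ℝ (Fin m) → ℝ)
    (x : EuclideanSpace ℝ (Fin n)) (y : EuclideanSpace ℝ (Fin m)) : EuclideanSpace ℝ (Fin n) :=
  gradient (fun x' => g x' y) x

/-- The partial gradient `∇_y g(x, y)`. -/
def gradY (g : EuclideanSpace ℝ (Fin n) → EuclideanSpace ℝ (Fin m) → ℝ)
    (x : EuclideanSpace ℝ (Fin n)) (y : EuclideanSpace ℝ (Fin m)) : EuclideanSpace ℝ (Fin m) :=
  gradient (fun y' => g x y') y

/-- The partial Hessian `∇²_yy g(x, y)`, as the derivative in `y` of `∇_y g(x, ·)`. -/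
def hessYY (g : EuclideanSpace ℝ (Fin n) → EuclideanSpace ℝ (Fin m) → ℝ)
    (x : EuclideanSpace ℝ (Fin n)) (y : EuclideanSpace ℝ (Fin m)) :
    EuclideanSpace ℝ (Fin m) →L[ℝ] EuclideanSpace ℝ (Fin m) :=
  fderiv ℝ (fun y' => gradY g x y') y

/-- `y` is a degenerate stationary point of `g(x, ·)`. -/
def IsDegenerateStationary (g : EuclideanSpace ℝ (Fin n) → EuclideanSpace ℝ (Fin m) → ℝ)
    (x : EuclideanSpace ℝ (Fin n)) (y : EuclideanSpace ℝ (Fin m)) : Prop :=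
  gradY g x y = 0 ∧ (hessYY g x y).det = 0

/-- `g(x, ·)` is a Morse function: all its stationary points are nondegenerate. -/
def IsMorse (g : EuclideanSpace ℝ (Fin n) → EuclideanSpace ℝ (Fin m) → ℝ)
    (x : EuclideanSpace ℝ (Fin n)) : Prop :=
  ∀ y, gradY g x y = 0 → (hessYY g x y).det ≠ 0

/-- The bifurcation point set: all `x ∈ X` for which `g(x, ·)` is not Morse. -/
def bifurcationSet (g : EuclideanSpace ℝ (Fin n) → EuclideanSpace ℝ (Fin m) → ℝ)
    (X : Set (EuclideanSpace ℝ (Fin n))) : Set (EuclideanSpace ℝ (Fin n)) :=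
  {x ∈ X | ¬ IsMorse g x}

/-- The points of `X` at distance at most `δ` from the bifurcation set (no points at all when the
bifurcation set is empty, the distance to the empty set being infinite). -/
def bifurcationNhd (g : EuclideanSpace ℝ (Fin n) → EuclideanSpace ℝ (Fin m) → ℝ)
    (X : Set (EuclideanSpace ℝ (Fin n))) (δ : ℝ) : Set (EuclideanSpace ℝ (Fin n)) :=
  X ∩ Metric.cthickening δ (bifurcationSet g X)

/-- The vector `∇_x (∇_y g(x, y)ᵀ v)`. -/
def crossGrad (g : EuclideanSpace ℝ (Fin n) → EuclideanSpace ℝ (Fin m) → ℝ)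
    (x : EuclideanSpace ℝ (Fin n)) (y v : EuclideanSpace ℝ (Fin m)) :
    EuclideanSpace ℝ (Fin n) :=
  gradient (fun x' => inner ℝ (gradY g x' y) v) x

/-- `x` is a fold bifurcation point associated with the stationary point `y`. -/
structure IsFold (g : EuclideanSpace ℝ (Fin n) → EuclideanSpace ℝ (Fin m) → ℝ)
    (x : EuclideanSpace ℝ (Fin n)) (y : EuclideanSpace ℝ (Fin m)) : Prop where
  contDiffAt : ContDiffAt ℝ 3 (Function.uncurry g) (x, y)
  stationary : gradY g x y = 0
  /-- Zero is a simple eigenvalue of the Hessian. -/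
  simple_zero : Module.finrank ℝ (LinearMap.ker (hessYY g x y).toLinearMap) = 1
  cross_ne_zero : ∀ v, ‖v‖ = 1 → hessYY g x y v = 0 → crossGrad g x y v ≠ 0
  third_ne_zero : ∀ v, ‖v‖ = 1 → hessYY g x y v = 0 →
    iteratedFDeriv ℝ 3 (fun y' => g x y') y (fun _ => v) ≠ 0

/-- The hyperplane through `x` with normal `w = ∇_x (∇_y g(x, y)ᵀ v)`, `v` a unit vector in the
kernel of the Hessian, is not tangent to `X` at `x`: there are points of `X` strictly on both of
its sides, or it meets `X` only at `x` and at a nonzero angle.  When `x` is an interior point of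
`X` the first alternative only says that `w ≠ 0`. -/
def NotTangent (g : EuclideanSpace ℝ (Fin n) → EuclideanSpace ℝ (Fin m) → ℝ)
    (X : Set (EuclideanSpace ℝ (Fin n)))
    (x : EuclideanSpace ℝ (Fin n)) (y : EuclideanSpace ℝ (Fin m)) : Prop :=
  ∀ v, ‖v‖ = 1 → hessYY g x y v = 0 →
    (∃ x₁ ∈ X, ∃ x₂ ∈ X, inner ℝ (crossGrad g x y v) (x₁ - x) < 0 ∧
      0 < inner ℝ (crossGrad g x y v) (x₂ - x)) ∨
    (∃ c : ℝ, 0 < c ∧ ∀ x' ∈ X, c * ‖x' - x‖ ≤ |inner ℝ (crossGrad g x y v) (x' - x)|)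

/-- `Crit(x)`: the stationary points of `g(x, ·)` in `Y'`. -/
def crit (g : EuclideanSpace ℝ (Fin n) → EuclideanSpace ℝ (Fin m) → ℝ)
    (Y' : Set (EuclideanSpace ℝ (Fin m))) (x : EuclideanSpace ℝ (Fin n)) :
    Set (EuclideanSpace ℝ (Fin m)) :=
  {y ∈ Y' | gradY g x y = 0}

/-- `Crit_r(x)`: the points at distance at most `r` from `Crit(x)`. -/
def critNhd (g : EuclideanSpace ℝ (Fin n) → EuclideanSpace ℝ (Fin m) → ℝ)
    (Y' : Set (EuclideanSpace ℝ (Fin m))) (r : ENNReal) (x : EuclideanSpace ℝ (Fin n)) :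
    Set (EuclideanSpace ℝ (Fin m)) :=
  {y | Metric.infEDist y (crit g Y' x) ≤ r}

/-- `μ(δ)`: the largest lower bound for the absolute values of the eigenvalues of `∇²_yy g` at the
stationary points in `Y'`, over all `x ∈ X` outside the `δ`-neighbourhood of the bifurcation set
(`∞` if there are none). -/
def mu (g : EuclideanSpace ℝ (Fin n) → EuclideanSpace ℝ (Fin m) → ℝ)
    (X : Set (EuclideanSpace ℝ (Fin n))) (Y' : Set (EuclideanSpace ℝ (Fin m)))
    (δ : ℝ) : ENNReal :=
  ⨅ x ∈ X \ bifurcationNhd g X δ, ⨅ y ∈ crit g Y' x,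
    ⨅ (l : ℝ) (_ : Module.End.HasEigenvalue (hessYY g x y).toLinearMap l), ENNReal.ofReal |l|

/-- `α(δ, r)`: the largest lower bound for `‖∇_y g(x, y)‖` over all `x ∈ X` outside the
`δ`-neighbourhood of the bifurcation set and all `y ∈ Y` outside `Crit_r(x)` (`∞` if there are
none). -/
def alpha (g : EuclideanSpace ℝ (Fin n) → EuclideanSpace ℝ (Fin m) → ℝ)
    (X : Set (EuclideanSpace ℝ (Fin n))) (Y Y' : Set (EuclideanSpace ℝ (Fin m)))
    (δ : ℝ) (r : ENNReal) : ENNReal :=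
  ⨅ x ∈ X \ bifurcationNhd g X δ, ⨅ y ∈ Y \ critNhd g Y' r x, ENNReal.ofReal ‖gradY g x y‖

end

end FoldBifurcation

/-!
Near a fold, a Lyapunov–Schmidt reduction turns the equation `∇_y g(x, y) = 0` into a scalar
equation `φ(x, s) = 0`, where `s` is the component of `y` along the kernel of the Hessian, `φ`
and `∂_s φ` vanish at the fold, and `∂_s² φ` does not. Let `a(x)` be the critical value of
`φ(x, ·)` near the fold. Where `a` vanishes, `φ(x, ·)` has a double zero, so `x` lies in the
bifurcation set. The derivative of `a` at the fold is `ξ ↦ wᵀ ξ`, so non-tangency makes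
`|a(x)|` bound the distance from `x ∈ X` to the bifurcation set, and Taylor's formula in `s` gives
`dist ≲ |φ| + (∂_s φ)²`.

At a stationary point `φ = 0`, and `|∂_s φ|` is at most a multiple of the smallest absolute value
of an eigenvalue of the Hessian: this is the square root law. At an arbitrary point `|φ|` is at
most a multiple of `‖∇_y g‖`. Either `(∂_s φ)² ≲ |φ|`, and then `dist ≲ ‖∇_y g‖`, or `φ(x, ·)`
changes sign within a Newton step `≲ |φ| / |∂_s φ|`, and there is a stationary point at distance
`≲ ‖∇_y g‖ ^ (1 / 2)`. Compactness of `X × Y'` and `X × Y` makes the constants uniform.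
-/

namespace FoldBifurcation

noncomputable section

open Filter Topology

section PartialDerivatives

variable {E F G : Type*} [NormedAddCommGroup E] [NormedSpace ℝ E] [NormedAddCommGroup F]
  [NormedSpace ℝ F] [NormedAddCommGroup G] [NormedSpace ℝ G]

/-- The partial derivative of `f` at `p` with respect to the first factor. -/
def partialFst (f : E × F → G) (p : E × F) : E →L[ℝ] G :=
  fderiv ℝ f p ∘L .inl ℝ E F

/-- The partial derivative of `f` at `p` with respect to the second factor. -/
def partialSnd (f : E × F → G) (p : E × F) : F →L[ℝ] G :=
  fderiv ℝ f p ∘L .inr ℝ E F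

/-- The partial derivative of `φ` at `q` with respect to its real variable, as a vector. -/
def derivSnd (φ : E × ℝ → G) (q : E × ℝ) : G :=
  partialSnd φ q 1

theorem fderiv_apply_eq_partialFst_add_partialSnd (f : E × F → G) (p w : E × F) :
    fderiv ℝ f p w = partialFst f p w.1 + partialSnd f p w.2 := by
  simp [partialFst, partialSnd, ← map_add]

theorem hasFDerivAt_partialSnd {f : E × F → G} {p : E × F} (hf : DifferentiableAt ℝ f p) :
    HasFDerivAt (fun y => f (p.1, y)) (partialSnd f p) p.2 :=
  hf.hasFDerivAt.comp p.2 (hasFDerivAt_prodMk_right p.1 p.2)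

theorem hasFDerivAt_partialFst {f : E × F → G} {p : E × F} (hf : DifferentiableAt ℝ f p) :
    HasFDerivAt (fun x => f (x, p.2)) (partialFst f p) p.1 :=
  hf.hasFDerivAt.comp p.1 (hasFDerivAt_prodMk_left p.1 p.2)

theorem contDiffAt_partialSnd {f : E × F → G} {p : E × F} {k l : ℕ∞ω} (hf : ContDiffAt ℝ l f p)
    (hkl : k + 1 ≤ l) : ContDiffAt ℝ k (partialSnd f) p :=
  (hf.fderiv_right hkl).clm_comp contDiffAt_const

theorem hasDerivAt_derivSnd {φ : E × ℝ → G} {q : E × ℝ} (hφ : DifferentiableAt ℝ φ q) :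
    HasDerivAt (fun t => φ (q.1, t)) (derivSnd φ q) q.2 :=
  (hasFDerivAt_partialSnd hφ).hasDerivAt

theorem contDiffAt_derivSnd {φ : E × ℝ → G} {q : E × ℝ} {k l : ℕ∞ω} (hφ : ContDiffAt ℝ l φ q)
    (hkl : k + 1 ≤ l) : ContDiffAt ℝ k (derivSnd φ) q :=
  (contDiffAt_partialSnd hφ hkl).clm_apply contDiffAt_const

end PartialDerivatives

section ImplicitSection

variable {E F G : Type*} [NormedAddCommGroup E] [NormedSpace ℝ E] [NormedAddCommGroup F]
  [NormedSpace ℝ F] [NormedAddCommGroup G] [NormedSpace ℝ G]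

theorem eventually_norm_sub_le_of_antilipschitz_partialSnd {f : E × F → G} {b : E × F}
    {f' : E × F →L[ℝ] G} (hf : HasStrictFDerivAt f f' b) {K : ℝ} (hK : 0 < K)
    (hbound : ∀ w, ‖w‖ ≤ K * ‖f' (0, w)‖) :
    ∀ᶠ z : (E × F) × F in 𝓝 (b, b.2),
      ‖z.1.2 - z.2‖ ≤ 2 * K * ‖f z.1 - f (z.1.1, z.2)‖ := by
  have hpair : Tendsto (fun z : (E × F) × F => (z.1, (z.1.1, z.2))) (𝓝 (b, b.2)) (𝓝 (b, b)) := by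
    have : Continuous fun z : (E × F) × F => (z.1, (z.1.1, z.2)) := by fun_prop
    exact this.tendsto (b, b.2)
  have hlin := hpair.eventually (hf.isLittleO.def (show 0 < 1 / (2 * K) by positivity))
  filter_upwards [hlin] with z hz
  have hdiff : z.1 - (z.1.1, z.2) = ((0 : E), z.1.2 - z.2) := by ext <;> simp
  rw [hdiff, Prod.norm_mk, norm_zero, max_eq_right (norm_nonneg _)] at hz
  have hder : ‖f' (0, z.1.2 - z.2)‖ ≤
      ‖f z.1 - f (z.1.1, z.2)‖ + 1 / (2 * K) * ‖z.1.2 - z.2‖ := by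
    linarith [norm_le_norm_add_norm_sub (f z.1 - f (z.1.1, z.2)) (f' (0, z.1.2 - z.2))]
  have := (hbound (z.1.2 - z.2)).trans (mul_le_mul_of_nonneg_left hder hK.le)
  have hhalf : K * (1 / (2 * K) * ‖z.1.2 - z.2‖) = ‖z.1.2 - z.2‖ / 2 := by
    field_simp
  linarith [mul_add K ‖f z.1 - f (z.1.1, z.2)‖ (1 / (2 * K) * ‖z.1.2 - z.2‖)]

theorem exists_implicitSection [CompleteSpace E] [CompleteSpace F] [CompleteSpace G]
    {f : E × F → G} {b : E × F} {k : ℕ∞ω} (hf : ContDiffAt ℝ k f b) (hk : k ≠ 0) (hzero : f b = 0)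
    (hinv : (partialSnd f b).IsInvertible) :
    ∃ σ : E → F, ContDiffAt ℝ k σ b.1 ∧ σ b.1 = b.2 ∧ (∀ᶠ x in 𝓝 b.1, f (x, σ x) = 0) ∧
      ∃ C > 0, ∀ᶠ p in 𝓝 b, ‖p.2 - σ p.1‖ ≤ C * ‖f p‖ := by
  set σ := hf.implicitFunction hk hinv
  have hσ : ContDiffAt ℝ k σ b.1 := hf.contDiffAt_implicitFunction hk hinv
  have hσb : σ b.1 = b.2 := hf.implicitFunction_apply_self hk hinv
  have hfσ : ∀ᶠ x in 𝓝 b.1, f (x, σ x) = 0 := by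
    simpa only [hzero] using hf.eventually_apply_implicitFunction hk hinv
  refine ⟨σ, hσ, hσb, hfσ, ?_⟩
  obtain ⟨e, he⟩ := hinv
  have hbound : ∀ w, ‖w‖ ≤ (‖(e.symm : G →L[ℝ] F)‖ + 1) * ‖fderiv ℝ f b (0, w)‖ := by
    intro w
    have hw : fderiv ℝ f b (0, w) = e w := by
      simpa [partialSnd] using (DFunLike.congr_fun he w).symm
    have := (e.symm : G →L[ℝ] F).le_opNorm (e w)
    rw [ContinuousLinearEquiv.coe_coe, e.symm_apply_apply] at this
    rw [hw]
    linarith [norm_nonneg (e w)]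
  refine ⟨2 * (‖(e.symm : G →L[ℝ] F)‖ + 1), by positivity, ?_⟩
  have hpair : Tendsto (fun p : E × F => (p, σ p.1)) (𝓝 b) (𝓝 (b, b.2)) := by
    rw [← hσb]
    exact (continuousAt_id.prodMk (hσ.continuousAt.comp continuousAt_fst)).tendsto
  filter_upwards [hpair.eventually (eventually_norm_sub_le_of_antilipschitz_partialSnd
    (hf.hasStrictFDerivAt hk) (by positivity) hbound), continuousAt_fst.eventually hfσ]
    with p hp hp0
  simpa only [hp0, sub_zero] using hp

end ImplicitSection

section Uniformity

theorem exists_pos_forall_of_eventually_nhdsWithin {α : Type*} [TopologicalSpace α] {K : Set α}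
    (hK : IsCompact K) {Q : ℝ → α → Prop} (hmono : ∀ p C C', C ≤ C' → Q C p → Q C' p)
    (hlocal : ∀ a ∈ K, ∃ C, ∀ᶠ p in 𝓝[K] a, Q C p) : ∃ C > 0, ∀ p ∈ K, Q C p := by
  obtain ⟨C, hC⟩ : ∃ C, ∀ p ∈ K, Q C p := by
    refine hK.induction_on (p := fun s => ∃ C, ∀ p ∈ s, Q C p) (by simp) ?_ ?_ ?_
    · rintro s t hst ⟨C, hC⟩
      exact ⟨C, fun p hp => hC p (hst hp)⟩
    · rintro s t ⟨C, hC⟩ ⟨C', hC'⟩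
      refine ⟨max C C', fun p hp => hp.elim (fun h => ?_) fun h => ?_⟩
      · exact hmono p _ _ (le_max_left C C') (hC p h)
      · exact hmono p _ _ (le_max_right C C') (hC' p h)
    · intro a ha
      obtain ⟨C, hC⟩ := hlocal a ha
      exact ⟨_, hC, C, fun p hp => hp⟩
  exact ⟨max C 1, by positivity, fun p hp => hmono p _ _ (le_max_left C 1) (hC p hp)⟩

theorem eventually_norm_le_mul_norm_apply_of_injective {α F G : Type*} [TopologicalSpace α]
    [NormedAddCommGroup F] [NormedSpace ℝ F] [FiniteDimensional ℝ F] [NormedAddCommGroup G]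
    [NormedSpace ℝ G] {T : α → F →L[ℝ] G} {a : α} (hT : ContinuousAt T a)
    (hinj : ∀ u, T a u = 0 → u = 0) :
    ∃ K > 0, ∀ᶠ p in 𝓝 a, ∀ u, ‖u‖ ≤ K * ‖T p u‖ := by
  obtain ⟨K, hK, hanti⟩ := LinearMap.exists_antilipschitzWith (T a).toLinearMap
    (LinearMap.ker_eq_bot'.2 hinj)
  have hKpos : (0 : ℝ) < K := hK
  refine ⟨2 * K, by positivity, ?_⟩
  filter_upwards [hT.eventually (Metric.ball_mem_nhds (T a) (inv_pos.2 (mul_pos two_pos hKpos)))]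
    with p hp u
  have hanti_u : ‖u‖ ≤ K * ‖T a u‖ := by
    simpa [dist_eq_norm] using hanti.le_mul_dist u 0
  have hclose : ‖T a u‖ ≤ ‖T p u‖ + (2 * K : ℝ)⁻¹ * ‖u‖ := by
    rw [dist_eq_norm'] at hp
    have := ((T a - T p).le_opNorm u).trans
      (mul_le_mul_of_nonneg_right hp.le (norm_nonneg u))
    rw [sub_apply] at this
    linarith [norm_le_norm_add_norm_sub' (T a u) (T p u)]
  have := hanti_u.trans (mul_le_mul_of_nonneg_left hclose hKpos.le)
  have hhalf : (K : ℝ) * ((2 * K : ℝ)⁻¹ * ‖u‖) = ‖u‖ / 2 := by field_simp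
  linarith [mul_add (K : ℝ) ‖T p u‖ ((2 * K : ℝ)⁻¹ * ‖u‖)]

theorem eventually_forall_mem_uIcc {α β : Type*} [TopologicalSpace α] {l : Filter β} {a : α}
    {c : ℝ} {P : α × ℝ → Prop} (hP : ∀ᶠ z in 𝓝 (a, c), P z) {x : β → α} {lo hi : β → ℝ}
    (hx : Tendsto x l (𝓝 a)) (hlo : Tendsto lo l (𝓝 c)) (hhi : Tendsto hi l (𝓝 c)) :
    ∀ᶠ y in l, ∀ t ∈ Set.uIcc (lo y) (hi y), P (x y, t) := by
  rw [nhds_prod_eq] at hP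
  obtain ⟨Pa, hPa, Pc, hPc, hPac⟩ := eventually_prod_iff.1 hP
  filter_upwards [hx.eventually hPa, (hlo.uIcc hhi).eventually (eventually_smallSets_forall.2 hPc)]
    with y hy hmem t ht
  exact hPac hy (hmem t ht)

end Uniformity

section NondegenerateZeros

variable {E F : Type*} [NormedAddCommGroup E] [NormedSpace ℝ E] [NormedAddCommGroup F]
  [NormedSpace ℝ F] [FiniteDimensional ℝ F] {f : E × F → F} {b : E × F}

theorem isInvertible_of_forall_eq_zero {H : F →L[ℝ] F}
    (hH : ∀ u, H u = 0 → u = 0) : H.IsInvertible :=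
  ⟨(LinearEquiv.ofInjectiveEndo H.toLinearMap
    ((injective_iff_map_eq_zero _).2 hH)).toContinuousLinearEquiv, by ext; rfl⟩

theorem eventually_one_le_sq_eigenvalue_of_nondegenerate (hf : ContDiffAt ℝ 1 f b)
    (hker : ∀ u, partialSnd f b u = 0 → u = 0) :
    ∃ C > 0, ∀ᶠ p in 𝓝 b, ∀ (l : ℝ) (u : F), u ≠ 0 → partialSnd f p u = l • u →
      1 ≤ C * l ^ 2 := by
  obtain ⟨K, hK, hbound⟩ := eventually_norm_le_mul_norm_apply_of_injective
    (contDiffAt_partialSnd hf (zero_add 1).le).continuousAt hker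
  refine ⟨K ^ 2, by positivity, ?_⟩
  filter_upwards [hbound] with p hbound l u hu hHu
  have hl : 1 ≤ K * |l| := by
    refine le_of_mul_le_mul_right ?_ (norm_pos_iff.2 hu)
    calc 1 * ‖u‖ ≤ K * ‖partialSnd f p u‖ := (one_mul ‖u‖).le.trans (hbound u)
      _ = K * |l| * ‖u‖ := by rw [hHu, norm_smul, Real.norm_eq_abs, mul_assoc]
  calc 1 ≤ (K * |l|) ^ 2 := one_le_pow₀ hl
    _ = K ^ 2 * l ^ 2 := by rw [mul_pow, sq_abs]

theorem eventually_exists_zero_of_nondegenerate [CompleteSpace E] (hf : ContDiffAt ℝ 1 f b)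
    (hzero : f b = 0) (hker : ∀ u, partialSnd f b u = 0 → u = 0) {N : Set F} (hN : N ∈ 𝓝 b.2) :
    ∃ C > 0, ∀ᶠ p in 𝓝 b, ∃ y ∈ N, f (p.1, y) = 0 ∧ ‖p.2 - y‖ ^ 2 ≤ C * ‖f p‖ := by
  have : CompleteSpace F := FiniteDimensional.complete ℝ F
  obtain ⟨σ, hσ, hσb, hσzero, C, hC, hdist⟩ :=
    exists_implicitSection hf one_ne_zero hzero (isInvertible_of_forall_eq_zero hker)
  have hσN : ∀ᶠ x in 𝓝 b.1, σ x ∈ N := hσ.continuousAt.eventually (by rwa [hσb])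
  have hsmall : ∀ᶠ p in 𝓝 b, ‖f p‖ < 1 :=
    hf.continuousAt.norm.eventually (gt_mem_nhds (by simp [hzero]))
  refine ⟨C ^ 2, by positivity, ?_⟩
  filter_upwards [continuousAt_fst.eventually hσzero, continuousAt_fst.eventually hσN, hdist,
    hsmall] with p hzero hmem hdist hsmall
  refine ⟨σ p.1, hmem, hzero, ?_⟩
  calc ‖p.2 - σ p.1‖ ^ 2 ≤ (C * ‖f p‖) ^ 2 := by gcongr
    _ = C ^ 2 * ‖f p‖ ^ 2 := mul_pow _ _ _
    _ ≤ C ^ 2 * ‖f p‖ := by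
        gcongr
        exact pow_le_of_le_one (norm_nonneg _) hsmall.le two_ne_zero

end NondegenerateZeros

section OneVariable

variable {φ φ' : ℝ → ℝ} {M : ℝ}

theorem abs_sub_taylor_le {r s : ℝ} (hM : 0 ≤ M)
    (hφ : ∀ t ∈ Set.uIcc r s, HasDerivAt φ (φ' t) t)
    (hφ' : ∀ t ∈ Set.uIcc r s, |φ' t - φ' r| ≤ M * |t - r|) :
    |φ s - φ r - φ' r * (s - r)| ≤ M * (s - r) ^ 2 := by
  have hder : ∀ t ∈ Set.uIcc r s,
      HasDerivWithinAt (fun t => φ t - φ' r * t) (φ' t - φ' r) (Set.uIcc r s) t := fun t ht => by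
    simpa using ((hφ t ht).fun_sub ((hasDerivAt_id t).const_mul (φ' r))).hasDerivWithinAt
  have hbound : ∀ t ∈ Set.uIcc r s, ‖φ' t - φ' r‖ ≤ M * |s - r| := fun t ht =>
    (hφ' t ht).trans (mul_le_mul_of_nonneg_left (Set.abs_sub_left_of_mem_uIcc ht) hM)
  have := (convex_uIcc r s).norm_image_sub_le_of_norm_hasDerivWithin_le hder hbound
    Set.left_mem_uIcc Set.right_mem_uIcc
  rw [Real.norm_eq_abs, Real.norm_eq_abs, mul_assoc, abs_mul_abs_self, ← pow_two] at this
  convert this using 2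
  ring

theorem exists_zero_mem_Icc_of_two_mul_abs_le {s τ : ℝ} (hM : 0 ≤ M) (hτ : 0 ≤ τ)
    (hφ : ∀ t ∈ Set.Icc (s - τ) (s + τ), HasDerivAt φ (φ' t) t)
    (hφ' : ∀ t ∈ Set.Icc (s - τ) (s + τ), |φ' t - φ' s| ≤ M * |t - s|)
    (hslope : 2 * (M * τ) ≤ |φ' s|) (hvalue : 2 * |φ s| ≤ |φ' s| * τ) :
    ∃ t ∈ Set.Icc (s - τ) (s + τ), φ t = 0 := by
  have hs : s ∈ Set.Icc (s - τ) (s + τ) := ⟨by linarith, by linarith⟩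
  have taylor : ∀ t ∈ Set.Icc (s - τ) (s + τ),
      |φ t - φ s - φ' s * (t - s)| ≤ M * (t - s) ^ 2 := fun t ht =>
    have hsub := Set.uIcc_subset_Icc hs ht
    abs_sub_taylor_le hM (fun r hr => hφ r (hsub hr)) fun r hr => hφ' r (hsub hr)
  have hright := abs_le.1 (taylor (s + τ) ⟨by linarith, le_rfl⟩)
  have hleft := abs_le.1 (taylor (s - τ) ⟨le_rfl, by linarith⟩)
  have hquad : 2 * (M * τ ^ 2) ≤ |φ' s| * τ := by nlinarith
  have hcont : ContinuousOn φ (Set.uIcc (s - τ) (s + τ)) := by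
    rw [Set.uIcc_of_le (by linarith)]
    exact fun t ht => (hφ t ht).continuousAt.continuousWithinAt
  have hzero : (0 : ℝ) ∈ Set.uIcc (φ (s - τ)) (φ (s + τ)) := by
    rw [Set.mem_uIcc]
    have := abs_le.1 (le_refl |φ s|)
    rcases abs_cases (φ' s) with ⟨hsign, -⟩ | ⟨hsign, -⟩ <;> rw [hsign] at hvalue hquad
    · exact Or.inl ⟨by linarith, by linarith⟩
    · exact Or.inr ⟨by linarith, by linarith⟩
  obtain ⟨t, ht, ht0⟩ := intermediate_value_uIcc hcont hzero
  rw [Set.uIcc_of_le (by linarith)] at ht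
  exact ⟨t, ht, ht0⟩

theorem exists_zero_of_mul_abs_le_sq {s : ℝ} (hM : 0 < M)
    (hφ : ∀ t ∈ Set.Icc (s - |φ' s| / (2 * M)) (s + |φ' s| / (2 * M)), HasDerivAt φ (φ' t) t)
    (hφ' : ∀ t ∈ Set.Icc (s - |φ' s| / (2 * M)) (s + |φ' s| / (2 * M)),
      |φ' t - φ' s| ≤ M * |t - s|)
    (hsmall : 4 * M * |φ s| ≤ φ' s ^ 2) :
    ∃ t ∈ Set.Icc (s - |φ' s| / (2 * M)) (s + |φ' s| / (2 * M)),
      φ t = 0 ∧ M * (s - t) ^ 2 ≤ |φ s| := by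
  have hradius : 0 ≤ |φ' s| / (2 * M) := by positivity
  rcases eq_or_ne (φ' s) 0 with hzero | hne
  · have hφs : φ s = 0 := by
      rw [← abs_nonpos_iff]
      rw [hzero] at hsmall
      nlinarith
    exact ⟨s, ⟨by linarith, by linarith⟩, hφs, by simp⟩
  have hpos : 0 < |φ' s| := abs_pos.2 hne
  rw [← sq_abs] at hsmall
  set τ := 2 * |φ s| / |φ' s|
  have hτ_mul : |φ' s| * τ = 2 * |φ s| := mul_div_cancel₀ _ hpos.ne'
  have hτ : 0 ≤ τ := by positivity
  have hslope : 2 * (M * τ) ≤ |φ' s| := by nlinarith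
  have hτ_le : τ ≤ |φ' s| / (2 * M) := by
    rw [le_div_iff₀ (by positivity)]
    linarith
  have hsub : Set.Icc (s - τ) (s + τ) ⊆ Set.Icc (s - |φ' s| / (2 * M)) (s + |φ' s| / (2 * M)) :=
    Set.Icc_subset_Icc (by linarith) (by linarith)
  obtain ⟨t, ht, ht0⟩ := exists_zero_mem_Icc_of_two_mul_abs_le hM.le hτ (fun t ht => hφ t (hsub ht))
    (fun t ht => hφ' t (hsub ht)) hslope hτ_mul.ge
  have hdist : |s - t| ≤ τ := abs_sub_le_iff.2 ⟨by linarith [ht.1], by linarith [ht.2]⟩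
  refine ⟨t, hsub ht, ht0, ?_⟩
  nlinarith [sq_abs (s - t), pow_le_pow_left₀ (abs_nonneg _) hdist 2]

end OneVariable

section Transversality

variable {E : Type*} [NormedAddCommGroup E] [NormedSpace ℝ E]

/-- The hyperplane `{x' | ℓ (x' - x) = 0}` is not tangent to `X` at `x`: either `X` has points
strictly on both of its sides, or it meets `X` only at `x` and at a nonzero angle. -/
def IsTransverse (X : Set E) (x : E) (ℓ : E →L[ℝ] ℝ) : Prop :=
  (∃ x₁ ∈ X, ∃ x₂ ∈ X, ℓ (x₁ - x) < 0 ∧ 0 < ℓ (x₂ - x)) ∨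
    ∃ c > 0, ∀ x' ∈ X, c * ‖x' - x‖ ≤ |ℓ (x' - x)|

theorem isTransverse_of_mem_interior {X : Set E} {x : E} (hx : x ∈ interior X) {ℓ : E →L[ℝ] ℝ}
    (hℓ : ℓ ≠ 0) : IsTransverse X x ℓ := by
  obtain ⟨w, hw⟩ : ∃ w, 0 < ℓ w := by
    obtain ⟨w, hw⟩ := DFunLike.ne_iff.1 hℓ
    rcases lt_or_gt_of_ne hw with h | h
    · exact ⟨-w, by simpa using h⟩
    · exact ⟨w, h⟩
  have hline : Tendsto (fun t : ℝ => x + t • w) (𝓝 0) (𝓝 x) := by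
    have : Continuous fun t : ℝ => x + t • w := by fun_prop
    simpa using this.tendsto 0
  have hmem : ∀ᶠ t : ℝ in 𝓝 0, x + t • w ∈ X := hline.eventually (mem_interior_iff_mem_nhds.1 hx)
  obtain ⟨ρ, hρ, hball⟩ := Metric.eventually_nhds_iff.1 hmem
  refine Or.inl ⟨_, hball (y := -(ρ / 2)) ?_, _, hball (y := ρ / 2) ?_, ?_, ?_⟩
  · rw [Real.dist_eq, sub_zero, abs_neg, abs_of_pos (by positivity)]
    linarith
  · rw [Real.dist_eq, sub_zero, abs_of_pos (by positivity)]
    linarith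
  · simpa using mul_pos (half_pos hρ) hw
  · simpa using mul_pos (half_pos hρ) hw

variable {a : E → ℝ} {ℓ : E →L[ℝ] ℝ} {x₀ : E}

theorem eventually_apply_lineMap_le_of_neg (ha : HasStrictFDerivAt a ℓ x₀) {x₁ : E}
    (hneg : ℓ (x₁ - x₀) < 0) :
    ∃ η > 0, ∀ᶠ z : E × ℝ in 𝓝 (x₀, 0),
      0 ≤ z.2 → a (z.1 + z.2 • (x₁ - z.1)) ≤ a z.1 - η * z.2 := by
  obtain ⟨ε, hε, hslope⟩ : ∃ ε > 0, ℓ (x₁ - x₀) + ε * ‖x₁ - x₀‖ < ℓ (x₁ - x₀) / 2 := by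
    refine ⟨-ℓ (x₁ - x₀) / (2 * (‖x₁ - x₀‖ + 1)), div_pos (by linarith) (by positivity), ?_⟩
    rw [← lt_sub_iff_add_lt', div_mul_eq_mul_div, div_lt_iff₀ (by positivity)]
    nlinarith [norm_nonneg (x₁ - x₀)]
  have hslope_near : ∀ᶠ x in 𝓝 x₀, ℓ (x₁ - x) + ε * ‖x₁ - x‖ < ℓ (x₁ - x₀) / 2 := by
    have : Continuous fun x => ℓ (x₁ - x) + ε * ‖x₁ - x‖ := by fun_prop
    exact this.continuousAt.eventually (gt_mem_nhds hslope)
  have hpair : Tendsto (fun z : E × ℝ => (z.1 + z.2 • (x₁ - z.1), z.1)) (𝓝 (x₀, 0))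
      (𝓝 (x₀, x₀)) := by
    have : Continuous fun z : E × ℝ => (z.1 + z.2 • (x₁ - z.1), z.1) := by fun_prop
    simpa using this.tendsto (x₀, 0)
  refine ⟨-ℓ (x₁ - x₀) / 2, by linarith, ?_⟩
  filter_upwards [hpair.eventually (ha.isLittleO.def hε), continuousAt_fst.eventually hslope_near]
    with z hlin hz ht
  rw [add_sub_cancel_left, map_smul, smul_eq_mul, norm_smul, Real.norm_of_nonneg ht] at hlin
  have := (abs_le.1 hlin).2
  nlinarith

theorem eventually_exists_zero_of_neg_direction (ha : HasStrictFDerivAt a ℓ x₀) (hzero : a x₀ = 0)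
    {X : Set E} (hX : Convex ℝ X) {x₁ : E} (hx₁ : x₁ ∈ X) (hneg : ℓ (x₁ - x₀) < 0)
    {N : Set E} (hN : N ∈ 𝓝 x₀) :
    ∃ C > 0, ∀ᶠ x in 𝓝 x₀, x ∈ X → 0 ≤ a x →
      ∃ x' ∈ X, x' ∈ N ∧ a x' = 0 ∧ ‖x - x'‖ ≤ C * |a x| := by
  obtain ⟨η, hη, hdescent⟩ := eventually_apply_lineMap_le_of_neg ha hneg
  have hline : Tendsto (fun z : E × ℝ => z.1 + z.2 • (x₁ - z.1)) (𝓝 (x₀, 0)) (𝓝 x₀) := by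
    have : Continuous fun z : E × ℝ => z.1 + z.2 • (x₁ - z.1) := by fun_prop
    simpa using this.tendsto (x₀, 0)
  obtain ⟨_, V, hV, hlip⟩ := ha.exists_lipschitzOnWith
  have hcont : ∀ᶠ x in 𝓝 x₀, ContinuousAt a x :=
    (eventually_mem_nhds_iff.2 hV).mono fun _ h => hlip.continuousOn.continuousAt h
  have hstep : Tendsto (fun x => a x / η) (𝓝 x₀) (𝓝 0) := by
    simpa [hzero] using ha.hasFDerivAt.continuousAt.tendsto.div_const η
  have hsegment := eventually_forall_mem_uIcc
    (hdescent.and ((hline.eventually (hcont.and hN)).and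
      (continuousAt_snd.eventually (gt_mem_nhds one_pos))))
    tendsto_id tendsto_const_nhds hstep
  refine ⟨(‖x₁ - x₀‖ + 1) / η, by positivity, ?_⟩
  filter_upwards [hsegment, Metric.ball_mem_nhds x₀ one_pos] with x hseg hx1 hx hax
  have hτ : 0 ≤ a x / η := by positivity
  rw [Set.uIcc_of_le hτ] at hseg
  have hpath : ContinuousOn (fun t : ℝ => a (x + t • (x₁ - x))) (Set.Icc 0 (a x / η)) :=
    fun t ht => (ContinuousAt.comp (f := fun t : ℝ => x + t • (x₁ - x)) (hseg t ht).2.1.1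
      (by fun_prop)).continuousWithinAt
  have hend : a (x + (a x / η) • (x₁ - x)) ≤ 0 := by
    simpa [mul_div_cancel₀ _ hη.ne'] using (hseg _ ⟨hτ, le_rfl⟩).1 hτ
  obtain ⟨t, ht, hat⟩ := intermediate_value_Icc' hτ hpath ⟨hend, by simpa using hax⟩
  obtain ⟨-, ⟨-, hmem⟩, ht1⟩ := hseg t ht
  refine ⟨_, hX.add_smul_sub_mem hx hx₁ ⟨ht.1, le_of_lt ht1⟩, hmem, hat, ?_⟩
  have hdist : ‖x₁ - x‖ ≤ ‖x₁ - x₀‖ + 1 := by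
    rw [mem_ball_iff_norm'] at hx1
    linarith [norm_sub_le_norm_sub_add_norm_sub x₁ x₀ x]
  rw [sub_add_cancel_left, norm_neg, norm_smul, Real.norm_of_nonneg ht.1, abs_of_nonneg hax]
  calc t * ‖x₁ - x‖ ≤ a x / η * (‖x₁ - x₀‖ + 1) := by gcongr; exact ht.2
    _ = (‖x₁ - x₀‖ + 1) / η * a x := by ring

theorem IsTransverse.eventually_exists_zero {X : Set E} (htrans : IsTransverse X x₀ ℓ)
    (hX : Convex ℝ X) (hx₀ : x₀ ∈ X) (ha : HasStrictFDerivAt a ℓ x₀) (hzero : a x₀ = 0)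
    {N : Set E} (hN : N ∈ 𝓝 x₀) :
    ∃ C > 0, ∀ᶠ x in 𝓝 x₀, x ∈ X → ∃ x' ∈ X, x' ∈ N ∧ a x' = 0 ∧ ‖x - x'‖ ≤ C * |a x| := by
  rcases htrans with ⟨x₁, hx₁, x₂, hx₂, hneg, hpos⟩ | ⟨c, hc, hangle⟩
  · obtain ⟨C₁, hC₁, h₁⟩ := eventually_exists_zero_of_neg_direction ha hzero hX hx₁ hneg hN
    obtain ⟨C₂, -, h₂⟩ := eventually_exists_zero_of_neg_direction (a := -a) ha.neg
      (by simpa using hzero) hX hx₂ (by simpa using hpos) hN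
    refine ⟨max C₁ C₂, by positivity, ?_⟩
    filter_upwards [h₁, h₂] with x hx₁ hx₂ hx
    rcases le_total 0 (a x) with hax | hax
    · obtain ⟨x', hx', hN', hzero', hdist⟩ := hx₁ hx hax
      exact ⟨x', hx', hN', hzero', hdist.trans (by gcongr; exact le_max_left _ _)⟩
    · obtain ⟨x', hx', hN', hzero', hdist⟩ := hx₂ hx (by simpa using hax)
      rw [Pi.neg_apply, abs_neg] at hdist
      exact ⟨x', hx', hN', by simpa using hzero', hdist.trans (by gcongr; exact le_max_right _ _)⟩
  · refine ⟨2 / c, by positivity, ?_⟩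
    filter_upwards [ha.hasFDerivAt.isLittleO.def (half_pos hc)] with x hlin hx
    rw [hzero, sub_zero, Real.norm_eq_abs] at hlin
    refine ⟨x₀, hx₀, mem_of_mem_nhds hN, hzero, ?_⟩
    rw [div_mul_eq_mul_div, le_div_iff₀ hc]
    linarith [hangle x hx, abs_sub_abs_le_abs_sub (ℓ (x - x₀)) (a x),
      abs_sub_comm (ℓ (x - x₀)) (a x)]

end Transversality

section ScalarFold

variable {E : Type*} [NormedAddCommGroup E] [NormedSpace ℝ E]

/-- `c` is a fold of the scalar equation `φ (x, t) = 0`: a double, but not triple, zero of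
`φ (c.1, ·)`. -/
structure IsScalarFoldAt (φ : E × ℝ → ℝ) (c : E × ℝ) : Prop where
  contDiffAt : ContDiffAt ℝ 2 φ c
  zero : φ c = 0
  derivSnd_zero : derivSnd φ c = 0
  derivSnd_derivSnd_ne_zero : derivSnd (derivSnd φ) c ≠ 0

variable {φ : E × ℝ → ℝ} {c : E × ℝ}

theorem exists_nhds_derivSnd_lipschitz (hφ : ContDiffAt ℝ 2 φ c) :
    ∃ M > 0, ∃ V ∈ 𝓝 c, (∀ q ∈ V, DifferentiableAt ℝ φ q) ∧
      ∀ q ∈ V, ∀ t, (q.1, t) ∈ V → |derivSnd φ (q.1, t) - derivSnd φ q| ≤ M * |t - q.2| := by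
  have hφ' : ContDiffAt ℝ 1 (derivSnd φ) c := contDiffAt_derivSnd hφ one_add_one_eq_two.le
  obtain ⟨M, V, hV, hlip⟩ := (hφ'.hasStrictFDerivAt one_ne_zero).exists_lipschitzOnWith
  have hdiff : ∀ᶠ q in 𝓝 c, DifferentiableAt ℝ φ q :=
    (hφ.eventually (by simp)).mono fun q hq => hq.differentiableAt two_ne_zero
  refine ⟨M + 1, by positivity, V ∩ {q | DifferentiableAt ℝ φ q}, inter_mem hV hdiff,
    fun q hq => hq.2, fun q hq t ht => ?_⟩
  have := hlip.dist_le_mul _ ht.1 _ hq.1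
  rw [Real.dist_eq, Prod.dist_eq, dist_self, Real.dist_eq, max_eq_right (abs_nonneg _)] at this
  linarith [abs_nonneg (t - q.2)]

namespace IsScalarFoldAt

theorem exists_criticalSection [CompleteSpace E] (hφ : IsScalarFoldAt φ c) :
    ∃ σ : E → ℝ, σ c.1 = c.2 ∧ ContDiffAt ℝ 1 σ c.1 ∧
      (∀ᶠ x in 𝓝 c.1, derivSnd φ (x, σ x) = 0) ∧
      ∃ C > 0, ∀ᶠ q in 𝓝 c, |q.2 - σ q.1| ≤ C * |derivSnd φ q| := by
  have hφ' : ContDiffAt ℝ 1 (derivSnd φ) c :=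
    contDiffAt_derivSnd hφ.contDiffAt one_add_one_eq_two.le
  have hinv : (partialSnd (derivSnd φ) c).IsInvertible :=
    ⟨.unitsEquivAut ℝ (Units.mk0 _ hφ.derivSnd_derivSnd_ne_zero), by ext; simp [derivSnd]⟩
  obtain ⟨σ, hσ, hσc, hzero, hdist⟩ :=
    exists_implicitSection hφ' one_ne_zero hφ.derivSnd_zero hinv
  exact ⟨σ, hσc, hσ, hzero, by simpa only [Real.norm_eq_abs] using hdist⟩

theorem hasStrictFDerivAt_criticalValue (hφ : IsScalarFoldAt φ c) {σ : E → ℝ}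
    (hσ : ContDiffAt ℝ 1 σ c.1) (hσc : σ c.1 = c.2) :
    HasStrictFDerivAt (fun x => φ (x, σ x)) (partialFst φ c) c.1 := by
  have hφc : HasStrictFDerivAt φ (fderiv ℝ φ c) (c.1, σ c.1) := by
    rw [hσc]
    exact hφ.contDiffAt.hasStrictFDerivAt two_ne_zero
  refine (hφc.comp c.1 ((hasStrictFDerivAt_id c.1).prodMk
    (hσ.hasStrictFDerivAt one_ne_zero))).congr_fderiv ?_
  have hker : partialSnd φ c = 0 := by
    ext
    exact hφ.derivSnd_zero
  ext ξ
  simp [fderiv_apply_eq_partialFst_add_partialSnd, hker]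

theorem eventually_abs_criticalValue_le (hφ : IsScalarFoldAt φ c) {σ : E → ℝ}
    (hσ : ContinuousAt σ c.1) (hσc : σ c.1 = c.2) (hcrit : ∀ᶠ x in 𝓝 c.1, derivSnd φ (x, σ x) = 0)
    {K : ℝ} (hdist : ∀ᶠ q in 𝓝 c, |q.2 - σ q.1| ≤ K * |derivSnd φ q|) :
    ∃ C > 0, ∀ᶠ q in 𝓝 c, |φ (q.1, σ q.1)| ≤ C * (|φ q| + derivSnd φ q ^ 2) := by
  obtain ⟨M, hM, V, hV, hdiff, hlip⟩ := exists_nhds_derivSnd_lipschitz hφ.contDiffAt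
  have hσ_tendsto : Tendsto (fun q : E × ℝ => σ q.1) (𝓝 c) (𝓝 c.2) := by
    rw [← hσc]
    exact (hσ.comp continuousAt_fst).tendsto
  refine ⟨1 + M * K ^ 2, by positivity, ?_⟩
  filter_upwards [eventually_forall_mem_uIcc (P := (· ∈ V)) hV continuousAt_fst hσ_tendsto
    continuousAt_snd, continuousAt_fst.eventually hcrit, hdist] with q hseg hcrit_q hdist_q
  have htaylor := abs_sub_taylor_le (φ := fun t => φ (q.1, t)) (φ' := fun t => derivSnd φ (q.1, t))
    hM.le (fun t ht => hasDerivAt_derivSnd (hdiff _ (hseg t ht)))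
    fun t ht => hlip _ (hseg _ Set.left_mem_uIcc) t (hseg t ht)
  have hsq : (q.2 - σ q.1) ^ 2 ≤ K ^ 2 * derivSnd φ q ^ 2 := by
    simpa only [mul_pow, sq_abs] using pow_le_pow_left₀ (abs_nonneg _) hdist_q 2
  rw [hcrit_q, zero_mul, sub_zero] at htaylor
  have := abs_sub_abs_le_abs_sub (φ (q.1, σ q.1)) (φ q)
  rw [abs_sub_comm] at this
  have hquad := mul_le_mul_of_nonneg_left hsq hM.le
  nlinarith [mul_nonneg (mul_nonneg hM.le (sq_nonneg K)) (abs_nonneg (φ q)),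
    sq_nonneg (derivSnd φ q)]

theorem eventually_exists_degenerate_zero [CompleteSpace E] (hφ : IsScalarFoldAt φ c) {X : Set E}
    (hX : Convex ℝ X) (hc : c.1 ∈ X) (htrans : IsTransverse X c.1 (partialFst φ c))
    {N : Set (E × ℝ)} (hN : N ∈ 𝓝 c) :
    ∃ C > 0, ∀ᶠ q in 𝓝 c, q.1 ∈ X → ∃ q' ∈ N, q'.1 ∈ X ∧ φ q' = 0 ∧ derivSnd φ q' = 0 ∧
      ‖q.1 - q'.1‖ ≤ C * (|φ q| + derivSnd φ q ^ 2) := by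
  obtain ⟨σ, hσc, hσ, hcrit, K, -, hdist⟩ := hφ.exists_criticalSection
  obtain ⟨C₁, hC₁, hvalue⟩ := hφ.eventually_abs_criticalValue_le hσ.continuousAt hσc hcrit hdist
  have hgraph : ∀ᶠ x in 𝓝 c.1, (x, σ x) ∈ N := by
    have : ContinuousAt (fun x => (x, σ x)) c.1 := continuousAt_id.prodMk hσ.continuousAt
    exact this.eventually (by simp only [hσc]; exact hN)
  obtain ⟨C₂, hC₂, hzero⟩ := htrans.eventually_exists_zero hX hc
    (hφ.hasStrictFDerivAt_criticalValue hσ hσc) (by rw [hσc]; exact hφ.zero) (hcrit.and hgraph)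
  refine ⟨C₂ * C₁, by positivity, ?_⟩
  filter_upwards [hvalue, continuousAt_fst.eventually hzero] with q hvalue_q hzero_q hq
  obtain ⟨x', hx', ⟨hcrit', hN'⟩, hzero', hdist'⟩ := hzero_q hq
  refine ⟨(x', σ x'), hN', hx', hzero', hcrit', hdist'.trans ?_⟩
  rw [mul_assoc]
  gcongr

theorem eventually_exists_zero_of_mul_abs_le_sq (hφ : IsScalarFoldAt φ c) {N : Set (E × ℝ)}
    (hN : N ∈ 𝓝 c) :
    ∃ M > 0, ∀ᶠ q in 𝓝 c, M * |φ q| ≤ derivSnd φ q ^ 2 →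
      ∃ s, (q.1, s) ∈ N ∧ φ (q.1, s) = 0 ∧ M * (q.2 - s) ^ 2 ≤ 4 * |φ q| := by
  obtain ⟨M, hM, V, hV, hdiff, hlip⟩ := exists_nhds_derivSnd_lipschitz hφ.contDiffAt
  have hslope : Tendsto (fun q => |derivSnd φ q| / (2 * M)) (𝓝 c) (𝓝 0) := by
    have : ContinuousAt (derivSnd φ) c :=
      (contDiffAt_derivSnd hφ.contDiffAt one_add_one_eq_two.le).continuousAt
    simpa [hφ.derivSnd_zero] using this.abs.tendsto.div_const (2 * M)
  have hinterval := eventually_forall_mem_uIcc (P := (· ∈ V ∩ N)) (inter_mem hV hN)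
    continuousAt_fst (by simpa using continuousAt_snd.tendsto.sub hslope)
    (by simpa using continuousAt_snd.tendsto.add hslope)
  refine ⟨4 * M, by positivity, ?_⟩
  filter_upwards [hinterval] with q hq hsmall
  have hradius : 0 ≤ |derivSnd φ q| / (2 * M) := by positivity
  rw [Set.uIcc_of_le (by linarith)] at hq
  have hself : q ∈ V := (hq q.2 ⟨by linarith, by linarith⟩).1
  obtain ⟨s, hs, hs0, hdist⟩ := exists_zero_of_mul_abs_le_sq (φ := fun t => φ (q.1, t))
    (φ' := fun t => derivSnd φ (q.1, t)) hM (fun t ht => hasDerivAt_derivSnd (hdiff _ (hq t ht).1))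
    (fun t ht => hlip q hself t (hq t ht).1) hsmall
  exact ⟨s, (hq s hs).2, hs0, by linarith⟩

end IsScalarFoldAt

end ScalarFold

section Reduction

variable {E F : Type*} [NormedAddCommGroup F] [InnerProductSpace ℝ F]

/-- The operator `H + v vᵀ`, invertible when the kernel of the symmetric operator `H` is spanned by
the unit vector `v`. -/
def stabilized (H : F →L[ℝ] F) (v : F) : F →L[ℝ] F :=
  H + (innerSL ℝ v).smulRight v

theorem stabilized_apply (H : F →L[ℝ] F) (v u : F) :
    stabilized H v u = H u + inner ℝ v u • v := rfl

theorem eq_zero_of_stabilized_apply_eq_zero {H : F →L[ℝ] F} {v : F} (hH : H.IsSymmetric)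
    (hv : ‖v‖ = 1) (hHv : H v = 0) (hker : ∀ u, H u = 0 → u ∈ Submodule.span ℝ {v}) {u : F}
    (hu : stabilized H v u = 0) : u = 0 := by
  have hvH : inner ℝ v (H u) = 0 := (hH v u).symm.trans (by simp [hHv])
  have hvu : inner ℝ v u = 0 := by
    have := congrArg (inner ℝ v) hu
    rwa [stabilized_apply, inner_add_right, inner_smul_right, hvH,
      inner_self_eq_one_of_norm_eq_one hv, inner_zero_right, zero_add, mul_one] at this
  rw [stabilized_apply, hvu, zero_smul, add_zero] at hu
  obtain ⟨t, rfl⟩ := Submodule.mem_span_singleton.1 (hker u hu)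
  rw [inner_smul_right, inner_self_eq_one_of_norm_eq_one hv, mul_one] at hvu
  rw [hvu, zero_smul]

/-- The coordinates `(x, ⟨v, y⟩)` of a point `(x, y)`, in which a fold in the direction `v` is
described by a scalar equation. -/
def kernelCoord (v : F) (p : E × F) : E × ℝ :=
  (p.1, inner ℝ v p.2)

theorem continuous_kernelCoord [TopologicalSpace E] (v : F) :
    Continuous (kernelCoord v : E × F → E × ℝ) :=
  continuous_fst.prodMk (continuous_const.inner continuous_snd)

/-- The function of `(x, s)` left to vanish after a Lyapunov–Schmidt reduction with solution map
`Y`. -/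
def reducedEquation (v : F) (Y : E × ℝ → F) (q : E × ℝ) : ℝ :=
  q.2 - inner ℝ v (Y q)

theorem abs_reducedEquation_kernelCoord_le {v : F} (hv : ‖v‖ = 1) (Y : E × ℝ → F) (p : E × F) :
    |reducedEquation v Y (kernelCoord v p)| ≤ ‖p.2 - Y (kernelCoord v p)‖ := by
  simpa only [reducedEquation, kernelCoord, inner_sub_right, hv, one_mul] using
    abs_real_inner_le_norm v (p.2 - Y (kernelCoord v p))

variable [NormedAddCommGroup E] [NormedSpace ℝ E]

/-- `b` is a fold, in the direction of the unit vector `v`, of the equation `f (x, y) = 0`, whose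
`y`-derivative is symmetric near `b`. -/
structure IsFoldAt (f : E × F → F) (b : E × F) (v : F) : Prop where
  contDiffAt : ContDiffAt ℝ 2 f b
  zero : f b = 0
  isSymmetric : ∀ᶠ p in 𝓝 b, (partialSnd f p).IsSymmetric
  norm_eq_one : ‖v‖ = 1
  partialSnd_apply : partialSnd f b v = 0
  mem_span_of_partialSnd_eq_zero : ∀ u, partialSnd f b u = 0 → u ∈ Submodule.span ℝ {v}
  second_ne_zero : inner ℝ v (partialSnd (partialSnd f) b v v) ≠ 0

/-- `Y` is a Lyapunov–Schmidt solution map for `f (x, y) = 0` near `b`: `y = Y (x, s)` solves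
`f (x, y) + (⟨v, y⟩ - s) v = 0`, an equation whose `y`-derivative is `stabilized`. -/
structure IsReduction (f : E × F → F) (b : E × F) (v : F) (Y : E × ℝ → F) : Prop where
  contDiffAt : ContDiffAt ℝ 2 Y (kernelCoord v b)
  apply_kernelCoord : Y (kernelCoord v b) = b.2
  apply_eq_smul : ∀ᶠ q in 𝓝 (kernelCoord v b), f (q.1, Y q) = reducedEquation v Y q • v
  norm_sub_le : ∃ C > 0, ∀ᶠ p in 𝓝 b, ‖p.2 - Y (kernelCoord v p)‖ ≤ C * ‖f p‖

variable {f : E × F → F} {b : E × F} {v : F} {Y : E × ℝ → F} {X : Set E}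

theorem hasFDerivAt_reducedEquation {q : E × ℝ} (hY : DifferentiableAt ℝ Y q) :
    HasFDerivAt (reducedEquation v Y)
      (ContinuousLinearMap.snd ℝ E ℝ - innerSL ℝ v ∘L fderiv ℝ Y q) q :=
  hasFDerivAt_snd.sub ((innerSL ℝ v).hasFDerivAt.comp q hY.hasFDerivAt)

theorem derivSnd_reducedEquation {q : E × ℝ} (hY : DifferentiableAt ℝ Y q) :
    derivSnd (reducedEquation v Y) q = 1 - inner ℝ v (derivSnd Y q) := by
  simp [derivSnd, partialSnd, (hasFDerivAt_reducedEquation hY).fderiv]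

theorem IsFoldAt.inner_partialSnd_apply (hf : IsFoldAt f b v) (u : F) :
    inner ℝ v (partialSnd f b u) = 0 :=
  (hf.isSymmetric.self_of_nhds v u).symm.trans (by simp [hf.partialSnd_apply])

theorem IsFoldAt.eq_zero_of_stabilized_apply_eq_zero (hf : IsFoldAt f b v) {u : F}
    (hu : stabilized (partialSnd f b) v u = 0) : u = 0 :=
  FoldBifurcation.eq_zero_of_stabilized_apply_eq_zero hf.isSymmetric.self_of_nhds hf.norm_eq_one
    hf.partialSnd_apply hf.mem_span_of_partialSnd_eq_zero hu

theorem IsFoldAt.exists_isReduction [CompleteSpace E] [FiniteDimensional ℝ F]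
    (hf : IsFoldAt f b v) : ∃ Y, IsReduction f b v Y := by
  have : CompleteSpace F := FiniteDimensional.complete ℝ F
  set Φ : (E × ℝ) × F → F := fun z => f (z.1.1, z.2) + (inner ℝ v z.2 - z.1.2) • v
  have hΦ : ContDiffAt ℝ 2 Φ (kernelCoord v b, b.2) := by
    have hproj : ContDiffAt ℝ 2 (fun z : (E × ℝ) × F => (z.1.1, z.2)) (kernelCoord v b, b.2) := by
      fun_prop
    have hfb : ContDiffAt ℝ 2 (fun z : (E × ℝ) × F => f (z.1.1, z.2)) (kernelCoord v b, b.2) :=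
      ContDiffAt.comp _ hf.contDiffAt hproj
    have hcoord : ContDiffAt ℝ 2 (fun z : (E × ℝ) × F => inner ℝ v z.2 - z.1.2)
        (kernelCoord v b, b.2) :=
      (contDiffAt_const.inner ℝ contDiffAt_snd).sub (by fun_prop)
    exact hfb.add (hcoord.smul contDiffAt_const)
  have hpartial : partialSnd Φ (kernelCoord v b, b.2) = stabilized (partialSnd f b) v := by
    have hslice : HasFDerivAt (fun y => f (b.1, y) + (inner ℝ v y - inner ℝ v b.2) • v)
        (stabilized (partialSnd f b) v) b.2 :=
      (hasFDerivAt_partialSnd (hf.contDiffAt.differentiableAt two_ne_zero)).add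
        (((innerSL ℝ v).hasFDerivAt.sub_const _).smul_const v)
    exact (hasFDerivAt_partialSnd (hΦ.differentiableAt two_ne_zero)).unique hslice
  obtain ⟨Y, hY, hYb, hzero, C, hC, hdist⟩ := exists_implicitSection hΦ two_ne_zero
    (by simp [Φ, kernelCoord, hf.zero])
    (hpartial ▸ isInvertible_of_forall_eq_zero fun _ => hf.eq_zero_of_stabilized_apply_eq_zero)
  refine ⟨Y, hY, hYb, hzero.mono fun q hq => ?_, C, hC, ?_⟩
  · rw [reducedEquation, ← sub_eq_zero, ← hq, ← sub_eq_zero]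
    module
  · have hlift : Tendsto (fun p : E × F => (kernelCoord v p, p.2)) (𝓝 b)
        (𝓝 (kernelCoord v b, b.2)) :=
      ((continuous_kernelCoord v).prodMk continuous_snd).tendsto b
    filter_upwards [hlift.eventually hdist] with p hp
    simpa [Φ, kernelCoord] using hp

namespace IsReduction

theorem continuousAt (hY : IsReduction f b v Y) : ContinuousAt Y (kernelCoord v b) :=
  hY.contDiffAt.continuousAt

theorem eventually_differentiableAt (hY : IsReduction f b v Y) :
    ∀ᶠ q in 𝓝 (kernelCoord v b), DifferentiableAt ℝ Y q :=
  (hY.contDiffAt.eventually (by simp)).mono fun _ hq => hq.differentiableAt two_ne_zero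

theorem graph_kernelCoord (hY : IsReduction f b v Y) :
    ((kernelCoord v b).1, Y (kernelCoord v b)) = b := by
  rw [hY.apply_kernelCoord, kernelCoord]

theorem tendsto_graph (hY : IsReduction f b v Y) :
    Tendsto (fun q => (q.1, Y q)) (𝓝 (kernelCoord v b)) (𝓝 b) := by
  have : ContinuousAt (fun q => (q.1, Y q)) (kernelCoord v b) :=
    continuousAt_fst.prodMk hY.continuousAt
  rwa [ContinuousAt, hY.graph_kernelCoord] at this

theorem eventually_fderiv_eq_smul (hY : IsReduction f b v Y) (hf : ContDiffAt ℝ 2 f b) :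
    ∀ᶠ q in 𝓝 (kernelCoord v b), ∀ w : E × ℝ,
      partialFst f (q.1, Y q) w.1 + partialSnd f (q.1, Y q) (fderiv ℝ Y q w) =
        fderiv ℝ (reducedEquation v Y) q w • v := by
  have hdiff : ∀ᶠ p in 𝓝 b, DifferentiableAt ℝ f p :=
    (hf.eventually (by simp)).mono fun _ hp => hp.differentiableAt two_ne_zero
  filter_upwards [hY.apply_eq_smul.eventually_nhds, hY.eventually_differentiableAt,
    hY.tendsto_graph.eventually hdiff] with q heq hYq hfq w
  have hleft := HasFDerivAt.comp q hfq.hasFDerivAt (hasFDerivAt_fst.prodMk hYq.hasFDerivAt)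
  have hright := (hasFDerivAt_reducedEquation (v := v)
    hYq).differentiableAt.hasFDerivAt.smul_const v
  rw [← fderiv_apply_eq_partialFst_add_partialSnd f (q.1, Y q) (w.1, fderiv ℝ Y q w)]
  simpa using DFunLike.congr_fun ((hleft.congr_of_eventuallyEq
    (heq.mono fun _ h => h.symm)).unique hright) w

theorem eventually_partialSnd_apply_derivSnd (hY : IsReduction f b v Y) (hf : ContDiffAt ℝ 2 f b) :
    ∀ᶠ q in 𝓝 (kernelCoord v b),
      partialSnd f (q.1, Y q) (derivSnd Y q) = derivSnd (reducedEquation v Y) q • v :=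
  (hY.eventually_fderiv_eq_smul hf).mono fun q hq => by
    simpa [derivSnd, partialSnd] using hq (0, 1)

theorem fderiv_reducedEquation (hY : IsReduction f b v Y) (hf : IsFoldAt f b v) (w : E × ℝ) :
    fderiv ℝ (reducedEquation v Y) (kernelCoord v b) w = inner ℝ v (partialFst f b w.1) := by
  have heq := (hY.eventually_fderiv_eq_smul hf.contDiffAt).self_of_nhds w
  rw [hY.graph_kernelCoord] at heq
  have hinner := congrArg (inner ℝ v) heq
  rw [inner_add_right, hf.inner_partialSnd_apply, add_zero, inner_smul_right,
    inner_self_eq_one_of_norm_eq_one hf.norm_eq_one, mul_one] at hinner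
  exact hinner.symm

theorem partialFst_reducedEquation (hY : IsReduction f b v Y) (hf : IsFoldAt f b v) :
    partialFst (reducedEquation v Y) (kernelCoord v b) = innerSL ℝ v ∘L partialFst f b := by
  ext ξ
  exact hY.fderiv_reducedEquation hf (ξ, 0)

theorem derivSnd_reducedEquation_eq_zero (hY : IsReduction f b v Y) (hf : IsFoldAt f b v) :
    derivSnd (reducedEquation v Y) (kernelCoord v b) = 0 := by
  simpa [derivSnd, partialSnd] using hY.fderiv_reducedEquation hf (0, 1)

theorem derivSnd_eq (hY : IsReduction f b v Y) (hf : IsFoldAt f b v) :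
    derivSnd Y (kernelCoord v b) = v := by
  have hslope := hY.derivSnd_reducedEquation_eq_zero hf
  have hker := (hY.eventually_partialSnd_apply_derivSnd hf.contDiffAt).self_of_nhds
  rw [hslope, zero_smul, hY.graph_kernelCoord] at hker
  rw [derivSnd_reducedEquation hY.eventually_differentiableAt.self_of_nhds, sub_eq_zero] at hslope
  refine sub_eq_zero.1 (hf.eq_zero_of_stabilized_apply_eq_zero ?_)
  rw [stabilized_apply, map_sub, hker, hf.partialSnd_apply, inner_sub_right, ← hslope,
    inner_self_eq_one_of_norm_eq_one hf.norm_eq_one]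
  simp

theorem contDiffAt_reducedEquation (hY : IsReduction f b v Y) :
    ContDiffAt ℝ 2 (reducedEquation v Y) (kernelCoord v b) :=
  contDiffAt_snd.sub (contDiffAt_const.inner ℝ hY.contDiffAt)

theorem reducedEquation_kernelCoord (hY : IsReduction f b v Y) :
    reducedEquation v Y (kernelCoord v b) = 0 := by
  rw [reducedEquation, hY.apply_kernelCoord, kernelCoord, sub_self]

theorem hasDerivAt_partialSnd_apply_derivSnd (hY : IsReduction f b v Y) (hf : IsFoldAt f b v) :
    HasDerivAt (fun t => partialSnd f (b.1, Y (b.1, t)) (derivSnd Y (b.1, t)))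
      (partialSnd (partialSnd f) b v v + partialSnd f b (derivSnd (derivSnd Y) (kernelCoord v b)))
      (inner ℝ v b.2) := by
  have hcoeff : HasFDerivAt (fun y => partialSnd f (b.1, y)) (partialSnd (partialSnd f) b) b.2 :=
    hasFDerivAt_partialSnd ((contDiffAt_partialSnd hf.contDiffAt
      one_add_one_eq_two.le).differentiableAt one_ne_zero)
  have hslice : HasDerivAt (fun t => Y (b.1, t)) v (inner ℝ v b.2) := by
    have := hasDerivAt_derivSnd hY.eventually_differentiableAt.self_of_nhds
    rwa [hY.derivSnd_eq hf] at this
  have hsecond : HasDerivAt (fun t => derivSnd Y (b.1, t))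
      (derivSnd (derivSnd Y) (kernelCoord v b)) (inner ℝ v b.2) :=
    hasDerivAt_derivSnd ((contDiffAt_derivSnd hY.contDiffAt
      one_add_one_eq_two.le).differentiableAt one_ne_zero)
  have hcomp : HasDerivAt (fun t => partialSnd f (b.1, Y (b.1, t)))
      (partialSnd (partialSnd f) b v) (inner ℝ v b.2) :=
    hcoeff.comp_hasDerivAt_of_eq _ hslice hY.apply_kernelCoord.symm
  have hprod := hcomp.clm_apply hsecond
  have hpoint : Y (b.1, inner ℝ v b.2) = b.2 := hY.apply_kernelCoord
  have hdirection : derivSnd Y (b.1, inner ℝ v b.2) = v := hY.derivSnd_eq hf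
  rwa [hpoint, hdirection] at hprod

theorem derivSnd_derivSnd_reducedEquation (hY : IsReduction f b v Y) (hf : IsFoldAt f b v) :
    derivSnd (derivSnd (reducedEquation v Y)) (kernelCoord v b) =
      inner ℝ v (partialSnd (partialSnd f) b v v) := by
  have hred := hasDerivAt_derivSnd ((contDiffAt_derivSnd hY.contDiffAt_reducedEquation
    one_add_one_eq_two.le).differentiableAt one_ne_zero)
  have heq : (fun t => partialSnd f (b.1, Y (b.1, t)) (derivSnd Y (b.1, t))) =ᶠ[𝓝 (inner ℝ v b.2)]
      fun t => derivSnd (reducedEquation v Y) (b.1, t) • v :=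
    (Continuous.prodMk_right b.1).continuousAt.eventually
      (hY.eventually_partialSnd_apply_derivSnd hf.contDiffAt)
  have hsecond := congrArg (inner ℝ v) ((hY.hasDerivAt_partialSnd_apply_derivSnd hf).unique
    ((hred.smul_const v).congr_of_eventuallyEq heq))
  have hsymm := hf.inner_partialSnd_apply (derivSnd (derivSnd Y) (kernelCoord v b))
  rw [inner_add_right, hsymm, add_zero, inner_smul_right,
    inner_self_eq_one_of_norm_eq_one hf.norm_eq_one, mul_one] at hsecond
  exact hsecond.symm

theorem isScalarFoldAt (hY : IsReduction f b v Y) (hf : IsFoldAt f b v) :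
    IsScalarFoldAt (reducedEquation v Y) (kernelCoord v b) where
  contDiffAt := hY.contDiffAt_reducedEquation
  zero := hY.reducedEquation_kernelCoord
  derivSnd_zero := hY.derivSnd_reducedEquation_eq_zero hf
  derivSnd_derivSnd_ne_zero :=
    hY.derivSnd_derivSnd_reducedEquation hf ▸ hf.second_ne_zero

end IsReduction

end Reduction

section DegenerateSet

/-- The distance from `x` to `S`, truncated at `1` so that it is finite when `S` is empty. -/
def cappedDist {E : Type*} [PseudoEMetricSpace E] (x : E) (S : Set E) : ENNReal :=
  min (Metric.infEDist x S) 1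

theorem cappedDist_le_of_one_le {E : Type*} [PseudoEMetricSpace E] {x : E} {S : Set E} {r : ℝ}
    (hr : 1 ≤ r) : cappedDist x S ≤ ENNReal.ofReal r :=
  (min_le_right _ _).trans (ENNReal.one_le_ofReal.2 hr)

theorem cappedDist_le_of_mem {E : Type*} [SeminormedAddCommGroup E] {x x' : E} {S : Set E} {r : ℝ}
    (hx' : x' ∈ S) (hr : ‖x - x'‖ ≤ r) : cappedDist x S ≤ ENNReal.ofReal r :=
  (min_le_left _ _).trans ((Metric.infEDist_le_edist_of_mem hx').trans (by
    rw [edist_dist, dist_eq_norm]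
    exact ENNReal.ofReal_le_ofReal hr))

/-- The parameters `x ∈ X` for which `f (x, y) = 0` has a degenerate solution `y`. -/
def degenerateSet {E F G : Type*} [NormedAddCommGroup E] [NormedSpace ℝ E]
    [NormedAddCommGroup F] [NormedSpace ℝ F] [NormedAddCommGroup G] [NormedSpace ℝ G]
    (f : E × F → G) (X : Set E) : Set E :=
  {x ∈ X | ∃ y, f (x, y) = 0 ∧ ∃ u ≠ 0, partialSnd f (x, y) u = 0}

variable {E F : Type*} [NormedAddCommGroup E] [NormedSpace ℝ E] [NormedAddCommGroup F]
  [InnerProductSpace ℝ F]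

/-- Over `X`, every zero of `f` is either nondegenerate or a fold whose bifurcation hyperplane is
not tangent to `X`. -/
def HasTransverseFolds (f : E × F → F) (X : Set E) : Prop :=
  ∀ p : E × F, p.1 ∈ X → f p = 0 → (∀ u, partialSnd f p u = 0 → u = 0) ∨
    ∃ v, IsFoldAt f p v ∧ IsTransverse X p.1 (innerSL ℝ v ∘L partialFst f p)

variable {f : E × F → F} {b : E × F} {v : F} {Y : E × ℝ → F} {X : Set E}

namespace IsReduction

theorem eventually_mem_degenerateSet (hY : IsReduction f b v Y) (hf : ContDiffAt ℝ 2 f b) :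
    ∀ᶠ q in 𝓝 (kernelCoord v b), q.1 ∈ X → reducedEquation v Y q = 0 →
      derivSnd (reducedEquation v Y) q = 0 → q.1 ∈ degenerateSet f X := by
  filter_upwards [hY.apply_eq_smul, hY.eventually_partialSnd_apply_derivSnd hf,
    hY.eventually_differentiableAt] with q hvalue hslope hdiff hq hzero hcrit
  refine ⟨hq, Y q, by rw [hvalue, hzero, zero_smul], derivSnd Y q, fun hYs => ?_,
    by rw [hslope, hcrit, zero_smul]⟩
  rw [derivSnd_reducedEquation hdiff, hYs, inner_zero_right, sub_zero] at hcrit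
  exact one_ne_zero hcrit

theorem eventually_cappedDist_le [CompleteSpace E] (hY : IsReduction f b v Y)
    (hf : IsFoldAt f b v) (hX : Convex ℝ X) (hb : b.1 ∈ X)
    (htrans : IsTransverse X b.1 (innerSL ℝ v ∘L partialFst f b)) :
    ∃ C > 0, ∀ᶠ p in 𝓝 b, p.1 ∈ X → cappedDist p.1 (degenerateSet f X) ≤
      ENNReal.ofReal (C * (|reducedEquation v Y (kernelCoord v p)| +
        derivSnd (reducedEquation v Y) (kernelCoord v p) ^ 2)) := by
  obtain ⟨C, hC, hdist⟩ := (hY.isScalarFoldAt hf).eventually_exists_degenerate_zero hX hb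
    (by rwa [hY.partialFst_reducedEquation hf])
    (hY.eventually_mem_degenerateSet (X := X) hf.contDiffAt)
  refine ⟨C, hC, ?_⟩
  filter_upwards [(continuous_kernelCoord v).continuousAt.eventually hdist] with p hp hpX
  obtain ⟨q, hdeg, hqX, hzero, hcrit, hq⟩ := hp hpX
  exact cappedDist_le_of_mem (hdeg hqX hzero hcrit) hq

theorem exists_lipschitz (hY : IsReduction f b v Y) :
    ∃ L : ℝ, ∃ V ∈ 𝓝 (kernelCoord v b), ∀ q ∈ V, ∀ s, (q.1, s) ∈ V →
      ‖Y q - Y (q.1, s)‖ ≤ L * |q.2 - s| := by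
  obtain ⟨L, V, hV, hlip⟩ := (hY.contDiffAt.of_le one_le_two).exists_lipschitzOnWith
  refine ⟨L, V, hV, fun q hq s hs => ?_⟩
  simpa [dist_eq_norm, Prod.norm_def] using hlip.norm_sub_le hq hs

theorem eventually_exists_zero_of_mul_abs_le_sq (hY : IsReduction f b v Y) (hf : IsFoldAt f b v)
    {N : Set F} (hN : N ∈ 𝓝 b.2) :
    ∃ M > 0, ∃ C : ℝ, ∀ᶠ p in 𝓝 b, M * |reducedEquation v Y (kernelCoord v p)| ≤
      derivSnd (reducedEquation v Y) (kernelCoord v p) ^ 2 →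
        ∃ y ∈ N, f (p.1, y) = 0 ∧ ‖p.2 - y‖ ^ 2 ≤ C * ‖f p‖ := by
  obtain ⟨K, hK, hgraph⟩ := hY.norm_sub_le
  obtain ⟨L, V, hV, hlip⟩ := hY.exists_lipschitz
  have hYN : ∀ᶠ q in 𝓝 (kernelCoord v b), Y q ∈ N :=
    hY.continuousAt.eventually (by rwa [hY.apply_kernelCoord])
  obtain ⟨M, hM, hnewton⟩ := (hY.isScalarFoldAt hf).eventually_exists_zero_of_mul_abs_le_sq
    (inter_mem (inter_mem hV hYN) hY.apply_eq_smul)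
  have hcoord := (continuous_kernelCoord (E := E) v).continuousAt (x := b)
  have hsmall : ∀ᶠ p in 𝓝 b, ‖f p‖ < 1 :=
    hf.contDiffAt.continuousAt.norm.eventually (gt_mem_nhds (by simp [hf.zero]))
  refine ⟨M, hM, 2 * K ^ 2 + 8 * L ^ 2 * K / M, ?_⟩
  filter_upwards [hgraph, hsmall, hcoord.eventually hnewton, hcoord.eventually hV]
    with p hgraph hsmall hnewton hpV hsteep
  obtain ⟨s, ⟨⟨hsV, hsN⟩, hs⟩, hzero, hstep⟩ := hnewton hsteep
  refine ⟨Y (p.1, s), hsN, hs.trans (by rw [hzero, zero_smul]), ?_⟩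
  have hstep' : ((kernelCoord v p).2 - s) ^ 2 ≤ 4 * (K * ‖f p‖) / M := by
    rw [le_div_iff₀' hM]
    exact hstep.trans (mul_le_mul_of_nonneg_left
      ((abs_reducedEquation_kernelCoord_le hf.norm_eq_one Y p).trans hgraph) zero_le_four)
  calc ‖p.2 - Y (p.1, s)‖ ^ 2
      ≤ (K * ‖f p‖ + L * |(kernelCoord v p).2 - s|) ^ 2 := by
        gcongr
        exact (norm_sub_le_norm_sub_add_norm_sub _ (Y (kernelCoord v p)) _).trans
          (add_le_add hgraph (hlip _ hpV s hsV))
    _ ≤ 2 * ((K * ‖f p‖) ^ 2 + (L * |(kernelCoord v p).2 - s|) ^ 2) := add_sq_le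
    _ = 2 * (K ^ 2 * ‖f p‖ ^ 2 + L ^ 2 * ((kernelCoord v p).2 - s) ^ 2) := by
        rw [mul_pow, mul_pow, sq_abs]
    _ ≤ 2 * (K ^ 2 * ‖f p‖ + L ^ 2 * (4 * (K * ‖f p‖) / M)) := by
        gcongr
        exact pow_le_of_le_one (norm_nonneg _) hsmall.le two_ne_zero
    _ = (2 * K ^ 2 + 8 * L ^ 2 * K / M) * ‖f p‖ := by ring

end IsReduction

theorem abs_le_of_eigenvector {H : F →L[ℝ] F} (hH : H.IsSymmetric) {u z : F} {c l K : ℝ}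
    (hv : ‖v‖ = 1) (hu : u ≠ 0) (hHu : H u = l • u) (hHz : H z = c • v) (hK : 0 < K)
    (hstab : ‖u‖ ≤ K * ‖stabilized H v u‖) : |c| ≤ 2 * K * ‖z‖ * |l| ∨ 1 ≤ 2 * K * |l| := by
  have hu_pos : 0 < ‖u‖ := norm_pos_iff.2 hu
  have hcross : c * inner ℝ v u = l * inner ℝ z u := by
    have := hH z u
    simpa [hHu, hHz, inner_smul_left, inner_smul_right] using this
  have hcross_le : |c| * |inner ℝ v u| ≤ |l| * (‖z‖ * ‖u‖) := by
    rw [← abs_mul, hcross, abs_mul]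
    gcongr
    exact abs_real_inner_le_norm z u
  have hcoercive : ‖u‖ ≤ K * (|l| * ‖u‖ + |inner ℝ v u|) :=
    hstab.trans (by
      gcongr
      rw [stabilized_apply, hHu]
      exact (norm_add_le _ _).trans (by simp [norm_smul, hv]))
  refine or_iff_not_imp_right.2 fun hl => ?_
  have hcoord : ‖u‖ ≤ 2 * K * |inner ℝ v u| := by nlinarith
  refine le_of_mul_le_mul_right ?_ hu_pos
  calc |c| * ‖u‖ ≤ |c| * (2 * K * |inner ℝ v u|) := by gcongr
    _ = 2 * K * (|c| * |inner ℝ v u|) := by ring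
    _ ≤ 2 * K * (|l| * (‖z‖ * ‖u‖)) := by gcongr
    _ = 2 * K * ‖z‖ * |l| * ‖u‖ := by ring

variable [FiniteDimensional ℝ F]

theorem IsFoldAt.eventually_norm_le_mul_norm_stabilized (hf : IsFoldAt f b v) :
    ∃ K > 0, ∀ᶠ p in 𝓝 b, ∀ u, ‖u‖ ≤ K * ‖stabilized (partialSnd f p) v u‖ := by
  have hcont : ContinuousAt (fun p => stabilized (partialSnd f p) v) b :=
    (contDiffAt_partialSnd hf.contDiffAt one_add_one_eq_two.le).continuousAt.add continuousAt_const
  exact eventually_norm_le_mul_norm_apply_of_injective hcont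
    fun _ => hf.eq_zero_of_stabilized_apply_eq_zero

theorem IsReduction.eventually_abs_derivSnd_le_of_eigenvector (hY : IsReduction f b v Y)
    (hf : IsFoldAt f b v) :
    ∃ C : ℝ, ∀ᶠ p in 𝓝 b, f p = 0 → ∀ (l : ℝ) (u : F), u ≠ 0 → partialSnd f p u = l • u →
      |derivSnd (reducedEquation v Y) (kernelCoord v p)| ≤ C * |l| ∨ 1 ≤ C * |l| := by
  obtain ⟨K, hK, hstab⟩ := hf.eventually_norm_le_mul_norm_stabilized
  obtain ⟨C, -, hdist⟩ := hY.norm_sub_le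
  have hcoord := (continuous_kernelCoord (E := E) v).continuousAt (x := b)
  have htangent : ∀ᶠ q in 𝓝 (kernelCoord v b), ‖derivSnd Y q‖ < 2 := by
    refine (contDiffAt_derivSnd hY.contDiffAt one_add_one_eq_two.le).continuousAt.norm.eventually
      (gt_mem_nhds ?_)
    change ‖derivSnd Y (kernelCoord v b)‖ < 2
    rw [hY.derivSnd_eq hf, hf.norm_eq_one]
    exact one_lt_two
  refine ⟨4 * K, ?_⟩
  filter_upwards [hdist, hf.isSymmetric, hstab, hcoord.eventually htangent,
    hcoord.eventually (hY.eventually_partialSnd_apply_derivSnd hf.contDiffAt)]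
    with p hp hsymm hstab htangent hslope hzero l u hu hHu
  have hgraph : ((kernelCoord v p).1, Y (kernelCoord v p)) = p := by
    rw [hzero, norm_zero, mul_zero, norm_le_zero_iff, sub_eq_zero] at hp
    rw [← hp, kernelCoord]
  rw [hgraph] at hslope
  refine (abs_le_of_eigenvector hsymm hf.norm_eq_one hu hHu hslope hK (hstab u)).imp
    (fun h => h.trans ?_) (fun h => h.trans ?_)
  · calc 2 * K * ‖derivSnd Y (kernelCoord v p)‖ * |l| ≤ 2 * K * 2 * |l| := by gcongr
      _ = 4 * K * |l| := by ring
  · gcongr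
    norm_num

theorem IsFoldAt.eventually_cappedDist_le_sq_eigenvalue [CompleteSpace E] (hf : IsFoldAt f b v)
    (hX : Convex ℝ X) (hb : b.1 ∈ X)
    (htrans : IsTransverse X b.1 (innerSL ℝ v ∘L partialFst f b)) :
    ∃ C : ℝ, ∀ᶠ p in 𝓝 b, p.1 ∈ X → f p = 0 → ∀ (l : ℝ) (u : F), u ≠ 0 →
      partialSnd f p u = l • u →
        cappedDist p.1 (degenerateSet f X) ≤ ENNReal.ofReal (C * l ^ 2) := by
  obtain ⟨Y, hY⟩ := hf.exists_isReduction
  obtain ⟨C, hC, hdist⟩ := hY.eventually_cappedDist_le hf hX hb htrans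
  obtain ⟨C', hslope⟩ := hY.eventually_abs_derivSnd_le_of_eigenvector hf
  obtain ⟨K, -, hgraph⟩ := hY.norm_sub_le
  refine ⟨max C 1 * C' ^ 2, ?_⟩
  filter_upwards [hdist, hslope, hgraph] with p hdist hslope hgraph hpX hzero l u hu hHu
  rcases hslope hzero l u hu hHu with hsmall | hlarge
  · have hred : reducedEquation v Y (kernelCoord v p) = 0 := by
      rw [hzero, norm_zero, mul_zero] at hgraph
      exact abs_nonpos_iff.1 ((abs_reducedEquation_kernelCoord_le hf.norm_eq_one Y p).trans hgraph)
    refine (hdist hpX).trans (ENNReal.ofReal_le_ofReal ?_)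
    calc C * (|reducedEquation v Y (kernelCoord v p)| +
          derivSnd (reducedEquation v Y) (kernelCoord v p) ^ 2)
        = C * |derivSnd (reducedEquation v Y) (kernelCoord v p)| ^ 2 := by
          rw [hred, abs_zero, zero_add, sq_abs]
      _ ≤ max C 1 * (C' * |l|) ^ 2 := by
          gcongr
          exact le_max_left C 1
      _ = max C 1 * C' ^ 2 * l ^ 2 := by rw [mul_pow, sq_abs, mul_assoc]
  · refine cappedDist_le_of_one_le ?_
    calc 1 = 1 * 1 ^ 2 := by norm_num
      _ ≤ max C 1 * (C' * |l|) ^ 2 := by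
          gcongr
          exact le_max_right C 1
      _ = max C 1 * C' ^ 2 * l ^ 2 := by rw [mul_pow, sq_abs, mul_assoc]

theorem IsFoldAt.eventually_cappedDist_le_norm_or_exists_zero [CompleteSpace E]
    (hf : IsFoldAt f b v) (hX : Convex ℝ X) (hb : b.1 ∈ X)
    (htrans : IsTransverse X b.1 (innerSL ℝ v ∘L partialFst f b)) {N : Set F} (hN : N ∈ 𝓝 b.2) :
    ∃ C : ℝ, ∀ᶠ p in 𝓝 b, p.1 ∈ X →
      cappedDist p.1 (degenerateSet f X) ≤ ENNReal.ofReal (C * ‖f p‖) ∨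
        ∃ y ∈ N, f (p.1, y) = 0 ∧ ‖p.2 - y‖ ^ 2 ≤ C * ‖f p‖ := by
  obtain ⟨Y, hY⟩ := hf.exists_isReduction
  obtain ⟨C, hC, hdist⟩ := hY.eventually_cappedDist_le hf hX hb htrans
  obtain ⟨K, -, hgraph⟩ := hY.norm_sub_le
  obtain ⟨M, hM, C', hzero⟩ := hY.eventually_exists_zero_of_mul_abs_le_sq hf hN
  refine ⟨max (C * ((1 + M) * K)) C', ?_⟩
  filter_upwards [hdist, hgraph, hzero] with p hdist hgraph hzero hpX
  rcases le_or_gt (M * |reducedEquation v Y (kernelCoord v p)|)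
    (derivSnd (reducedEquation v Y) (kernelCoord v p) ^ 2) with hsteep | hflat
  · obtain ⟨y, hyN, hy, hle⟩ := hzero hsteep
    exact Or.inr ⟨y, hyN, hy, hle.trans (by gcongr; exact le_max_right _ _)⟩
  · refine Or.inl ((hdist hpX).trans (ENNReal.ofReal_le_ofReal ?_))
    calc C * (|reducedEquation v Y (kernelCoord v p)| +
          derivSnd (reducedEquation v Y) (kernelCoord v p) ^ 2)
        ≤ C * ((1 + M) * |reducedEquation v Y (kernelCoord v p)|) := by
          gcongr
          linarith
      _ ≤ C * ((1 + M) * (K * ‖f p‖)) := by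
          gcongr
          exact (abs_reducedEquation_kernelCoord_le hf.norm_eq_one Y p).trans hgraph
      _ = C * ((1 + M) * K) * ‖f p‖ := by ring
      _ ≤ max (C * ((1 + M) * K)) C' * ‖f p‖ := by
          gcongr
          exact le_max_left _ _

theorem eventually_cappedDist_le_sq_eigenvalue [CompleteSpace E] (hX : Convex ℝ X) (hb : b.1 ∈ X)
    (hf : ContDiffAt ℝ 1 f b) (hfold : HasTransverseFolds f X) :
    ∃ C : ℝ, ∀ᶠ p in 𝓝 b, p.1 ∈ X → f p = 0 → ∀ (l : ℝ) (u : F), u ≠ 0 →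
      partialSnd f p u = l • u →
        cappedDist p.1 (degenerateSet f X) ≤ ENNReal.ofReal (C * l ^ 2) := by
  by_cases hzero : f b = 0
  · rcases hfold b hb hzero with hker | ⟨v, hv, htrans⟩
    · obtain ⟨C, -, h⟩ := eventually_one_le_sq_eigenvalue_of_nondegenerate hf hker
      exact ⟨C, h.mono fun p hp _ _ l u hu hHu => cappedDist_le_of_one_le (hp l u hu hHu)⟩
    · exact hv.eventually_cappedDist_le_sq_eigenvalue hX hb htrans
  · exact ⟨0, (hf.continuousAt.eventually_ne hzero).mono fun p hp _ h => absurd h hp⟩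

theorem eventually_cappedDist_le_norm_or_exists_zero [CompleteSpace E] (hX : Convex ℝ X)
    (hb : b.1 ∈ X) (hf : ContDiffAt ℝ 1 f b) (hfold : HasTransverseFolds f X) {N : Set F}
    (hN : N ∈ 𝓝 b.2) :
    ∃ C : ℝ, ∀ᶠ p in 𝓝 b, p.1 ∈ X →
      cappedDist p.1 (degenerateSet f X) ≤ ENNReal.ofReal (C * ‖f p‖) ∨
        ∃ y ∈ N, f (p.1, y) = 0 ∧ ‖p.2 - y‖ ^ 2 ≤ C * ‖f p‖ := by
  by_cases hzero : f b = 0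
  · rcases hfold b hb hzero with hker | ⟨v, hv, htrans⟩
    · obtain ⟨C, -, h⟩ := eventually_exists_zero_of_nondegenerate hf hzero hker hN
      exact ⟨C, h.mono fun p hp _ => Or.inr hp⟩
    · exact hv.eventually_cappedDist_le_norm_or_exists_zero hX hb htrans hN
  · have hpos : 0 < ‖f b‖ := norm_pos_iff.2 hzero
    refine ⟨2 / ‖f b‖, ?_⟩
    filter_upwards [hf.continuousAt.norm.eventually (lt_mem_nhds (half_lt_self hpos))]
      with p hp _
    refine Or.inl (cappedDist_le_of_one_le ?_)
    rw [div_mul_eq_mul_div, one_le_div hpos]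
    linarith

theorem exists_cappedDist_le_sq_eigenvalue [CompleteSpace E] {K : Set F} (hX : Convex ℝ X)
    (hXc : IsCompact X) (hK : IsCompact K) (hf : ∀ p : E × F, p.1 ∈ X → ContDiffAt ℝ 1 f p)
    (hfold : HasTransverseFolds f X) :
    ∃ C > 0, ∀ p ∈ X ×ˢ K, f p = 0 → ∀ (l : ℝ) (u : F), u ≠ 0 → partialSnd f p u = l • u →
      cappedDist p.1 (degenerateSet f X) ≤ ENNReal.ofReal (C * l ^ 2) := by
  refine exists_pos_forall_of_eventually_nhdsWithin (hXc.prod hK)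
    (fun p C C' hCC' hp hzero l u hu hHu => (hp hzero l u hu hHu).trans (by gcongr)) fun b hb => ?_
  obtain ⟨C, h⟩ := eventually_cappedDist_le_sq_eigenvalue hX hb.1 (hf b hb.1) hfold
  refine ⟨C, ?_⟩
  filter_upwards [h.filter_mono nhdsWithin_le_nhds, self_mem_nhdsWithin] with p hp hpX
  exact hp hpX.1

theorem exists_cappedDist_le_norm_or_exists_zero [CompleteSpace E] {K N : Set F}
    (hX : Convex ℝ X) (hXc : IsCompact X) (hK : IsCompact K) (hKN : K ⊆ interior N)
    (hf : ∀ p : E × F, p.1 ∈ X → ContDiffAt ℝ 1 f p) (hfold : HasTransverseFolds f X) :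
    ∃ C > 0, ∀ p ∈ X ×ˢ K, cappedDist p.1 (degenerateSet f X) ≤ ENNReal.ofReal (C * ‖f p‖) ∨
      ∃ y ∈ N, f (p.1, y) = 0 ∧ ‖p.2 - y‖ ^ 2 ≤ C * ‖f p‖ := by
  refine exists_pos_forall_of_eventually_nhdsWithin (hXc.prod hK)
    (fun p C C' hCC' => Or.imp (fun h => h.trans (by gcongr))
      fun ⟨y, hyN, hy, h⟩ => ⟨y, hyN, hy, h.trans (by gcongr)⟩) fun b hb => ?_
  obtain ⟨C, h⟩ := eventually_cappedDist_le_norm_or_exists_zero hX hb.1 (hf b hb.1) hfold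
    (mem_interior_iff_mem_nhds.1 (hKN hb.2))
  refine ⟨C, ?_⟩
  filter_upwards [h.filter_mono nhdsWithin_le_nhds, self_mem_nhdsWithin] with p hp hpX
  exact hp hpX.1

end DegenerateSet

section Gradient

variable {F : Type*} [NormedAddCommGroup F] [InnerProductSpace ℝ F] [CompleteSpace F] {h : F → ℝ}
  {y : F}

theorem contDiffAt_gradient {k l : ℕ∞ω} (hh : ContDiffAt ℝ l h y) (hkl : k + 1 ≤ l) :
    ContDiffAt ℝ k (gradient h) y :=
  (InnerProductSpace.toDual ℝ F).symm.contDiff.contDiffAt.comp y (hh.fderiv_right hkl)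

theorem inner_fderiv_gradient (hh : ContDiffAt ℝ 2 h y) (u u' : F) :
    inner ℝ (fderiv ℝ (gradient h) y u) u' = fderiv ℝ (fderiv ℝ h) y u u' := by
  have hgrad : HasFDerivAt (fun z => inner ℝ u' (gradient h z))
      (innerSL ℝ u' ∘L fderiv ℝ (gradient h) y) y :=
    (innerSL ℝ u').hasFDerivAt.comp y ((contDiffAt_gradient hh
      one_add_one_eq_two.le).differentiableAt one_ne_zero).hasFDerivAt
  have hfderiv := ((hh.fderiv_right one_add_one_eq_two.le).differentiableAt
    one_ne_zero).hasFDerivAt.clm_apply (hasFDerivAt_const u' y)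
  have heq : (fun z => inner ℝ u' (gradient h z)) = fun z => fderiv ℝ h z u' := by
    ext z
    rw [real_inner_comm, inner_gradient_left]
  rw [heq] at hgrad
  rw [real_inner_comm]
  simpa using DFunLike.congr_fun (hgrad.unique hfderiv) u

theorem isSymmetric_fderiv_gradient (hh : ContDiffAt ℝ 2 h y) :
    (fderiv ℝ (gradient h) y).IsSymmetric := fun u u' => by
  rw [ContinuousLinearMap.coe_coe, inner_fderiv_gradient hh, real_inner_comm,
    inner_fderiv_gradient hh]
  exact hh.isSymmSndFDerivAt (by simp) u u'

theorem inner_fderiv_fderiv_gradient (hh : ContDiffAt ℝ 3 h y) (v : F) :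
    inner ℝ v (fderiv ℝ (fderiv ℝ (gradient h)) y v v) = iteratedFDeriv ℝ 3 h y fun _ => v := by
  have hquad : (fun z => iteratedFDeriv ℝ 2 h z fun _ => v) =ᶠ[𝓝 y]
      fun z => inner ℝ v (fderiv ℝ (gradient h) z v) := by
    filter_upwards [(hh.of_le (Nat.cast_le.2 (by norm_num : 2 ≤ 3))).eventually (by simp)]
      with z hz
    rw [iteratedFDeriv_two_apply, real_inner_comm, inner_fderiv_gradient hz]
  have hleft : DifferentiableAt ℝ (iteratedFDeriv ℝ 2 h) y :=
    (hh.iteratedFDeriv_right (m := 1) (i := 2) (by norm_num)).differentiableAt one_ne_zero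
  have hgrad : DifferentiableAt ℝ (fderiv ℝ (gradient h)) y :=
    ((contDiffAt_gradient hh two_add_one_eq_three.le).fderiv_right
      one_add_one_eq_two.le).differentiableAt one_ne_zero
  have hright : HasFDerivAt (fun z => inner ℝ v (fderiv ℝ (gradient h) z v)) _ y :=
    (innerSL ℝ v).hasFDerivAt.comp y (hgrad.hasFDerivAt.clm_apply (hasFDerivAt_const v y))
  have heq := DFunLike.congr_fun (hquad.fderiv_eq.trans hright.fderiv) v
  rw [fderiv_continuousMultilinear_apply_const_apply hleft] at heq
  rw [iteratedFDeriv_succ_apply_left]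
  simpa [Fin.tail_def] using heq.symm

end Gradient

section Stationary

variable {n m : ℕ} {g : EuclideanSpace ℝ (Fin n) → EuclideanSpace ℝ (Fin m) → ℝ}
  {p : EuclideanSpace ℝ (Fin n) × EuclideanSpace ℝ (Fin m)} {X : Set (EuclideanSpace ℝ (Fin n))}
  {Y Y' : Set (EuclideanSpace ℝ (Fin m))} {C δ : ℝ}

theorem uncurry_gradY_eq (hg : DifferentiableAt ℝ (Function.uncurry g) p) :
    Function.uncurry (gradY g) p =
      (InnerProductSpace.toDual ℝ _).symm (partialSnd (Function.uncurry g) p) :=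
  congrArg (InnerProductSpace.toDual ℝ _).symm (hasFDerivAt_partialSnd hg).fderiv

theorem contDiffAt_uncurry_gradY {k l : ℕ∞ω} (hg : ContDiffAt ℝ l (Function.uncurry g) p)
    (hkl : k + 1 ≤ l) : ContDiffAt ℝ k (Function.uncurry (gradY g)) p := by
  have hdual : ContDiffAt ℝ k
      (fun q => (InnerProductSpace.toDual ℝ _).symm (partialSnd (Function.uncurry g) q)) p :=
    (InnerProductSpace.toDual ℝ _).symm.contDiff.contDiffAt.comp p (contDiffAt_partialSnd hg hkl)
  refine hdual.congr_of_eventuallyEq ?_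
  filter_upwards [(hg.of_le (le_add_self.trans hkl)).eventually (by simp)] with q hq
  exact uncurry_gradY_eq (hq.differentiableAt one_ne_zero)

theorem partialSnd_uncurry_gradY (hg : ContDiffAt ℝ 2 (Function.uncurry g) p) :
    partialSnd (Function.uncurry (gradY g)) p = hessYY g p.1 p.2 :=
  (hasFDerivAt_partialSnd ((contDiffAt_uncurry_gradY hg
    one_add_one_eq_two.le).differentiableAt one_ne_zero)).fderiv.symm

theorem innerSL_crossGrad (hg : ContDiffAt ℝ 2 (Function.uncurry g) p)
    (v : EuclideanSpace ℝ (Fin m)) :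
    innerSL ℝ (crossGrad g p.1 p.2 v) =
      innerSL ℝ v ∘L partialFst (Function.uncurry (gradY g)) p := by
  have hslice : HasFDerivAt (fun x => inner ℝ v (gradY g x p.2))
      (innerSL ℝ v ∘L partialFst (Function.uncurry (gradY g)) p) p.1 :=
    (innerSL ℝ v).hasFDerivAt.comp p.1 (hasFDerivAt_partialFst ((contDiffAt_uncurry_gradY hg
      one_add_one_eq_two.le).differentiableAt one_ne_zero))
  ext ξ
  rw [innerSL_apply_apply, crossGrad, inner_gradient_left, ← hslice.fderiv]
  simp only [real_inner_comm v]

theorem contDiffAt_slice {k : ℕ∞ω} (hg : ContDiffAt ℝ k (Function.uncurry g) p) :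
    ContDiffAt ℝ k (g p.1) p.2 :=
  ContDiffAt.comp p.2 (g := Function.uncurry g) (f := fun y => (p.1, y)) hg
    (contDiffAt_const.prodMk contDiffAt_id)

theorem isSymmetric_partialSnd_uncurry_gradY (hg : ContDiffAt ℝ 2 (Function.uncurry g) p) :
    (partialSnd (Function.uncurry (gradY g)) p).IsSymmetric := by
  rw [partialSnd_uncurry_gradY hg]
  exact isSymmetric_fderiv_gradient (contDiffAt_slice hg)

theorem partialSnd_partialSnd_uncurry_gradY (hg : ContDiffAt ℝ 3 (Function.uncurry g) p) :
    partialSnd (partialSnd (Function.uncurry (gradY g))) p =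
      fderiv ℝ (fderiv ℝ (gradient (g p.1))) p.2 := by
  have hslice := hasFDerivAt_partialSnd ((contDiffAt_partialSnd (contDiffAt_uncurry_gradY hg
    two_add_one_eq_three.le) one_add_one_eq_two.le).differentiableAt one_ne_zero)
  have heq : ∀ᶠ q in 𝓝 p, partialSnd (Function.uncurry (gradY g)) q = hessYY g q.1 q.2 := by
    filter_upwards [(hg.of_le (Nat.cast_le.2 (by norm_num : 2 ≤ 3))).eventually (by simp)]
      with q hq
    exact partialSnd_uncurry_gradY hq
  rw [← hslice.fderiv]
  have hev : (fun y => partialSnd (Function.uncurry (gradY g)) (p.1, y)) =ᶠ[𝓝 p.2]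
      fun y => hessYY g p.1 y :=
    (Continuous.prodMk_right p.1).continuousAt.eventually heq
  exact hev.fderiv_eq

theorem IsFold.exists_isFoldAt (hfold : IsFold g p.1 p.2) :
    ∃ v, hessYY g p.1 p.2 v = 0 ∧ IsFoldAt (Function.uncurry (gradY g)) p v := by
  obtain ⟨u, hu, hspan⟩ := finrank_eq_one_iff'.1 hfold.simple_zero
  have hu_ne : (u : EuclideanSpace ℝ (Fin m)) ≠ 0 := fun h => hu (Subtype.ext h)
  set v := ‖(u : EuclideanSpace ℝ (Fin m))‖⁻¹ • (u : EuclideanSpace ℝ (Fin m))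
  have hv : ‖v‖ = 1 := norm_smul_inv_norm hu_ne
  have hHv : hessYY g p.1 p.2 v = 0 := by
    rw [map_smul, show hessYY g p.1 p.2 u = 0 from u.2, smul_zero]
  have hg := hfold.contDiffAt
  have hg2 : ContDiffAt ℝ 2 (Function.uncurry g) p :=
    hg.of_le (Nat.cast_le.2 (by norm_num : 2 ≤ 3))
  refine ⟨v, hHv, contDiffAt_uncurry_gradY hg two_add_one_eq_three.le, hfold.stationary,
    (hg2.eventually (by simp)).mono fun q hq => isSymmetric_partialSnd_uncurry_gradY hq, hv,
    by rw [partialSnd_uncurry_gradY hg2, hHv], fun w hw => ?_, ?_⟩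
  · rw [partialSnd_uncurry_gradY hg2] at hw
    obtain ⟨c, hc⟩ := hspan ⟨w, hw⟩
    refine Submodule.mem_span_singleton.2 ⟨c * ‖(u : EuclideanSpace ℝ (Fin m))‖, ?_⟩
    rw [smul_smul, mul_assoc, mul_inv_cancel₀ (norm_ne_zero_iff.2 hu_ne), mul_one]
    exact congrArg Subtype.val hc
  · rw [partialSnd_partialSnd_uncurry_gradY hg, inner_fderiv_fderiv_gradient (contDiffAt_slice hg)]
    exact hfold.third_ne_zero v hv hHv

theorem det_eq_zero_iff_exists_ne_zero {V : Type*} [NormedAddCommGroup V] [NormedSpace ℝ V]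
    [FiniteDimensional ℝ V] {T : V →L[ℝ] V} : T.det = 0 ↔ ∃ u ≠ 0, T u = 0 := by
  rw [ContinuousLinearMap.det, LinearMap.det_eq_zero_iff_ker_ne_bot, Submodule.ne_bot_iff]
  exact exists_congr fun u => and_comm

theorem degenerateSet_uncurry_gradY
    (hg : ∀ p : EuclideanSpace ℝ (Fin n) × EuclideanSpace ℝ (Fin m), p.1 ∈ X →
      ContDiffAt ℝ 2 (Function.uncurry g) p) :
    degenerateSet (Function.uncurry (gradY g)) X = bifurcationSet g X := by
  ext x
  simp only [degenerateSet, bifurcationSet, IsMorse, Set.mem_ofPred_eq, not_forall, not_not,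
    exists_prop]
  refine and_congr_right fun hx => exists_congr fun y => and_congr_right fun _ => ?_
  rw [det_eq_zero_iff_exists_ne_zero, partialSnd_uncurry_gradY (hg (x, y) hx)]

theorem hasTransverseFolds_uncurry_gradY
    (hg : ∀ p : EuclideanSpace ℝ (Fin n) × EuclideanSpace ℝ (Fin m), p.1 ∈ X →
      ContDiffAt ℝ 2 (Function.uncurry g) p)
    (hfold : ∀ x ∈ X, ∀ y, IsDegenerateStationary g x y → IsFold g x y)
    (htan : ∀ x ∈ frontier X, ∀ y, IsDegenerateStationary g x y → NotTangent g X x y) :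
    HasTransverseFolds (Function.uncurry (gradY g)) X := by
  refine fun p hp hzero => or_iff_not_imp_left.2 fun hker => ?_
  have hdeg : IsDegenerateStationary g p.1 p.2 := by
    refine ⟨hzero, det_eq_zero_iff_exists_ne_zero.2 ?_⟩
    push Not at hker
    simpa only [partialSnd_uncurry_gradY (hg p hp), and_comm] using hker
  have hp_fold := hfold p.1 hp p.2 hdeg
  obtain ⟨v, hHv, hv⟩ := hp_fold.exists_isFoldAt
  refine ⟨v, hv, ?_⟩
  rw [← innerSL_crossGrad (hg p hp)]
  by_cases hint : p.1 ∈ interior X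
  · refine isTransverse_of_mem_interior hint ?_
    rw [← norm_ne_zero_iff, innerSL_apply_norm, norm_ne_zero_iff]
    exact hp_fold.cross_ne_zero v hv.norm_eq_one hHv
  · exact htan p.1 ⟨subset_closure hp, hint⟩ p.2 hdeg v hv.norm_eq_one hHv

theorem ofReal_min_le_cappedDist {x : EuclideanSpace ℝ (Fin n)}
    (hx : x ∈ X \ bifurcationNhd g X δ) :
    ENNReal.ofReal (min δ 1) ≤ cappedDist x (bifurcationSet g X) := by
  refine le_min ((ENNReal.ofReal_le_ofReal (min_le_left δ 1)).trans ?_)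
    (ENNReal.ofReal_le_one.2 (min_le_right δ 1))
  exact (not_le.1 fun h => hx.2 ⟨hx.1, Metric.mem_cthickening_iff.2 h⟩).le

theorem ofReal_mul_sqrt_le_mu (hC : 0 < C)
    (hbound : ∀ x ∈ X, ∀ y ∈ crit g Y' x, ∀ (l : ℝ) (u : EuclideanSpace ℝ (Fin m)), u ≠ 0 →
      hessYY g x y u = l • u →
        cappedDist x (bifurcationSet g X) ≤ ENNReal.ofReal (C * l ^ 2)) :
    ENNReal.ofReal (√C⁻¹ * √(min δ 1)) ≤ mu g X Y' δ := by
  refine le_iInf₂ fun x hx => le_iInf₂ fun y hy => le_iInf₂ fun l hl => ?_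
  obtain ⟨u, hu⟩ := hl.exists_hasEigenvector
  have hle : min δ 1 ≤ C * l ^ 2 := (ENNReal.ofReal_le_ofReal_iff (by positivity)).1
    ((ofReal_min_le_cappedDist hx).trans (hbound x hx.1 y hy l u hu.2 hu.apply_eq_smul))
  refine ENNReal.ofReal_le_ofReal ?_
  rw [← Real.sqrt_mul (by positivity), ← Real.sqrt_sq_eq_abs]
  exact Real.sqrt_le_sqrt ((inv_mul_le_iff₀ hC).2 hle)

theorem ofReal_mul_min_le_alpha {κ : ℝ} {r : ENNReal} (hC : 0 < C) (hκ : 0 ≤ κ) (hδ : 0 ≤ δ)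
    (hr : ENNReal.ofReal (κ * √(min δ 1)) ≤ r)
    (hbound : ∀ x ∈ X, ∀ y ∈ Y,
      cappedDist x (bifurcationSet g X) ≤ ENNReal.ofReal (C * ‖gradY g x y‖) ∨
        ∃ y' ∈ crit g Y' x, ‖y - y'‖ ^ 2 ≤ C * ‖gradY g x y‖) :
    ENNReal.ofReal (min 1 (κ ^ 2) / C * min δ 1) ≤ alpha g X Y Y' δ r := by
  refine le_iInf₂ fun x hx => le_iInf₂ fun y hy => ENNReal.ofReal_le_ofReal ?_
  have hδ1 : 0 ≤ min δ 1 := le_min hδ zero_le_one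
  rw [div_mul_eq_mul_div, div_le_iff₀' hC]
  rcases hbound x hx.1 y hy.1 with hnear | ⟨y', hy', hdist⟩
  · have hle : min δ 1 ≤ C * ‖gradY g x y‖ := (ENNReal.ofReal_le_ofReal_iff (by positivity)).1
      ((ofReal_min_le_cappedDist hx).trans hnear)
    exact (mul_le_of_le_one_left hδ1 (min_le_left _ _)).trans hle
  · have hfar : κ * √(min δ 1) < ‖y - y'‖ := by
      have := (hr.trans_lt (not_le.1 hy.2)).trans_le (Metric.infEDist_le_edist_of_mem hy')
      rwa [edist_dist, ENNReal.ofReal_lt_ofReal_iff_of_nonneg (by positivity), dist_eq_norm]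
        at this
    calc min 1 (κ ^ 2) * min δ 1 ≤ κ ^ 2 * min δ 1 := by
          gcongr
          exact min_le_right _ _
      _ = (κ * √(min δ 1)) ^ 2 := by rw [mul_pow, Real.sq_sqrt hδ1]
      _ ≤ ‖y - y'‖ ^ 2 := by gcongr
      _ ≤ C * ‖gradY g x y‖ := hdist

end Stationary

end

end FoldBifurcation

open FoldBifurcation in
theorem mainTheorem6_general {n m : ℕ}
    (g : EuclideanSpace ℝ (Fin n) → EuclideanSpace ℝ (Fin m) → ℝ)
    (X : Set (EuclideanSpace ℝ (Fin n))) (Y Y' : Set (EuclideanSpace ℝ (Fin m)))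
    (hg : ∀ p : EuclideanSpace ℝ (Fin n) × EuclideanSpace ℝ (Fin m), p.1 ∈ X →
      ContDiffAt ℝ 2 (Function.uncurry g) p)
    (hXconv : Convex ℝ X) (hXcomp : IsCompact X) (hY : IsCompact Y) (hY' : IsCompact Y')
    (hYY' : Y ⊆ interior Y')
    (hfold : ∀ x ∈ X, ∀ y, IsDegenerateStationary g x y → IsFold g x y)
    (htan : ∀ x ∈ frontier X, ∀ y, IsDegenerateStationary g x y → NotTangent g X x y)
    {c : ℝ} (hc : 0 < c) :
    ∃ D₁ D₂ D₃ D₄ : ℝ, 0 < D₁ ∧ 0 < D₂ ∧ 0 < D₃ ∧ 0 < D₄ ∧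
      ∀ δ : ℝ, 0 < δ →
        ENNReal.ofReal (min (D₁ * √δ) D₂) ≤ mu g X Y' δ ∧
        ENNReal.ofReal (min (D₃ * δ) D₄) ≤
          alpha g X Y Y' δ (mu g X Y' δ / ENNReal.ofReal c) := by
  have hf : ∀ p : EuclideanSpace ℝ (Fin n) × EuclideanSpace ℝ (Fin m), p.1 ∈ X →
      ContDiffAt ℝ 1 (Function.uncurry (gradY g)) p := fun p hp =>
    contDiffAt_uncurry_gradY (hg p hp) one_add_one_eq_two.le
  have hfolds := hasTransverseFolds_uncurry_gradY hg hfold htan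
  obtain ⟨C, hC, heigen⟩ := exists_cappedDist_le_sq_eigenvalue hXconv hXcomp hY' hf hfolds
  obtain ⟨C', hC', hzero⟩ :=
    exists_cappedDist_le_norm_or_exists_zero hXconv hXcomp hY hYY' hf hfolds
  rw [degenerateSet_uncurry_gradY hg] at heigen hzero
  refine ⟨√C⁻¹, √C⁻¹, min 1 ((√C⁻¹ / c) ^ 2) / C', min 1 ((√C⁻¹ / c) ^ 2) / C', by positivity,
    by positivity, by positivity, by positivity, fun δ hδ => ?_⟩
  have hmu : ENNReal.ofReal (√C⁻¹ * √(min δ 1)) ≤ mu g X Y' δ :=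
    ofReal_mul_sqrt_le_mu hC fun x hx y hy l u hu hHu => heigen (x, y) ⟨hx, hy.1⟩ hy.2 l u hu
      ((DFunLike.congr_fun (partialSnd_uncurry_gradY (hg (x, y) hx)) u).trans hHu)
  have hradius := ENNReal.div_le_div_right hmu (ENNReal.ofReal c)
  rw [← ENNReal.ofReal_div_of_pos hc, mul_div_right_comm] at hradius
  have halpha := ofReal_mul_min_le_alpha hC' (by positivity) hδ.le hradius fun x hx y hy =>
    (hzero (x, y) ⟨hx, hy⟩).imp_right fun ⟨y', hy', hstat, hdist⟩ => ⟨y', ⟨hy', hstat⟩, hdist⟩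
  rw [Real.sqrt_monotone.map_min, Real.sqrt_one, mul_min_of_nonneg _ _ (by positivity),
    mul_one] at hmu
  rw [mul_min_of_nonneg _ _ (by positivity), mul_one] at halpha
  exact ⟨hmu, halpha⟩

theorem mainTheorem6 {n m : ℕ}
    (g : EuclideanSpace ℝ (Fin n) → EuclideanSpace ℝ (Fin m) → ℝ)
    (X : Set (EuclideanSpace ℝ (Fin n))) (Y Y' : Set (EuclideanSpace ℝ (Fin m)))
    (y₀ : EuclideanSpace ℝ (Fin m)) (L₁ L₂ gLow : ℝ)
    -- `g` is smooth on a neighbourhood of `X × ℝᵐ`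
    (O : Set (EuclideanSpace ℝ (Fin n) × EuclideanSpace ℝ (Fin m)))
    (hO : IsOpen O) (hXO : X ×ˢ Set.univ ⊆ O)
    (hg : ContDiffOn ℝ ∞ (Function.uncurry g) O)
    (hXconv : Convex ℝ X) (hXcomp : IsCompact X)
    -- the full gradient is `L₁`-Lipschitz, the Hessian in `y` is `L₂`-Lipschitz
    (hL₁ : ∀ x ∈ X, ∀ x' ∈ X, ∀ y y',
      √(‖FoldBifurcation.gradX g x y - FoldBifurcation.gradX g x' y'‖ ^ 2 +
          ‖FoldBifurcation.gradY g x y - FoldBifurcation.gradY g x' y'‖ ^ 2) ≤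
        L₁ * √(‖x - x'‖ ^ 2 + ‖y - y'‖ ^ 2))
    (hL₂pos : 0 < L₂)
    (hL₂ : ∀ x ∈ X, ∀ x' ∈ X, ∀ y y',
      ‖FoldBifurcation.hessYY g x y - FoldBifurcation.hessYY g x' y'‖ ≤
        L₂ * √(‖x - x'‖ ^ 2 + ‖y - y'‖ ^ 2))
    (hlow : ∀ x ∈ X, ∀ y, gLow ≤ g x y)
    -- the sublevel sets at `y₀` are compact and lie in the compact set `Y`
    (hY : IsCompact Y) (hy₀ : y₀ ∈ Y)
    (hsub : ∀ x ∈ X, IsCompact {y | g x y ≤ g x y₀} ∧ {y | g x y ≤ g x y₀} ⊆ Y)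
    (hY' : IsCompact Y') (hYY' : Y ⊆ interior Y')
    -- all degenerate stationary points are fold bifurcation points
    (hfold : ∀ x ∈ X, ∀ y, FoldBifurcation.IsDegenerateStationary g x y →
      FoldBifurcation.IsFold g x y)
    -- over the boundary of `X`, the fold hypersurface is not tangent to `X`
    (htan : ∀ x ∈ frontier X, ∀ y, FoldBifurcation.IsDegenerateStationary g x y →
      FoldBifurcation.NotTangent g X x y) :
    ∃ D₁ D₂ D₃ D₄ : ℝ, 0 < D₁ ∧ 0 < D₂ ∧ 0 < D₃ ∧ 0 < D₄ ∧
      ∀ δ : ℝ, 0 < δ →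
        ENNReal.ofReal (min (D₁ * √δ) D₂) ≤ FoldBifurcation.mu g X Y' δ ∧
        ENNReal.ofReal (min (D₃ * δ) D₄) ≤
          FoldBifurcation.alpha g X Y Y' δ
            (FoldBifurcation.mu g X Y' δ / ENNReal.ofReal (2 * L₂)) :=
  mainTheorem6_general g X Y Y' (fun _ hp => (hg.contDiffAt (hO.mem_nhds
    (hXO ⟨hp, Set.mem_univ _⟩))).of_le (WithTop.coe_le_coe.2 (le_top (a := (2 : ℕ∞)))))
    hXconv hXcomp hY hY' hYY' hfold htan (mul_pos two_pos hL₂pos)
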